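/- Call a finite simple graph $G=(V,E)$ \emph{irreducible} if it contains no $K_4$, no induced diamond ($K_4$ minus one edge), and no two distinct vertices $u,v$ with $N(u)\subseteq N(v)$. \textbf{Theorem.} There are an algorithm (a program of a random access machine with addition, truncated subtraction, indirect loads and stores, and unit cost per instruction and per test) and a constant $C$ such that the following holds. Let $G$ be an irreducible graph with $n$ vertices, diameter $2$ and minimum degree $\delta$. Given $n$ and the adjacency matrix of $G$, the algorithm halts and correctly decides whether $G$ is $3$-colorable, in time $2^{O(\min\{\delta,\frac{n}{\delta}\log\delta\})}$ up to a factor polynomial in $n$. That is, it halts after at most $$n^{C}\cdot 2^{\,C\min\{\delta,\ \frac{n}{\delta}\log_2\delta\}}$$ steps. Moreover, whenever $\delta\ge\log_2 n$, it halts after at most $2^{\,C\min\{\delta,\ \frac{n}{\delta}\log_2\delta\}}$ steps, without the polynomial factor. -/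

import Mathlib

/-- A finite simple graph is irreducible (for 3-colouring) if it is `K₄`-free, has no induced
diamond (so no two vertices can be merged by diamond elimination) and has no siblings (so no
vertex can be removed by siblings elimination). -/
structure ThreeColIrreducible {V : Type*} (G : SimpleGraph V) : Prop where
  cliqueFree : G.CliqueFree 4
  /-- No four vertices carry all the six possible edges but exactly one, namely `u₁u₂`. -/
  diamondFree : ¬ ∃ u₁ u₂ u₃ u₄ : V, u₁ ≠ u₂ ∧ ¬ G.Adj u₁ u₂ ∧ G.Adj u₃ u₄ ∧
    G.Adj u₁ u₃ ∧ G.Adj u₁ u₄ ∧ G.Adj u₂ u₃ ∧ G.Adj u₂ u₄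
  /-- Distinct vertices with `N(u) ⊆ N(v)` are automatically non-adjacent. -/
  siblingsFree : ¬ ∃ u v : V, u ≠ v ∧ G.neighborSet u ⊆ G.neighborSet v

namespace RAM

/-- Programs of a random access machine with registers `0, 1, 2, …` (a program mentions only
finitely many of them) and a memory whose cells are addressed by natural numbers. The only
arithmetic is addition and truncated subtraction; in particular there is no multiplication, so
the bit length of every value grows by at most one per step, and unit cost is polynomially
equivalent to Turing machine time. -/
inductive Prog : Type
  | skip : Prog
  /-- `reg d := k` -/
  | const (d k : ℕ) : Prog
  /-- `reg d := reg a + reg b` -/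
  | add (d a b : ℕ) : Prog
  /-- `reg d := reg a - reg b`, and `0` if `reg a < reg b` -/
  | sub (d a b : ℕ) : Prog
  /-- `reg d := mem (reg a)` -/
  | load (d a : ℕ) : Prog
  /-- `mem (reg a) := reg b` -/
  | store (a b : ℕ) : Prog
  | seq (p q : Prog) : Prog
  /-- if `reg a ≠ 0` then `p` else `q` -/
  | ite (a : ℕ) (p q : Prog) : Prog
  /-- while `reg a ≠ 0` do `p` -/
  | loop (a : ℕ) (p : Prog) : Prog

/-- The contents of the registers and of the memory. -/
structure State : Type where
  reg : ℕ → ℕ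
  mem : ℕ → ℕ

/-- Write the value `v` into register `d`. -/
def State.setReg (s : State) (d v : ℕ) : State := ⟨Function.update s.reg d v, s.mem⟩

/-- Write the value `v` into memory cell `k`. -/
def State.setMem (s : State) (k v : ℕ) : State := ⟨s.reg, Function.update s.mem k v⟩

/-- `Exec p s t s'`: started in state `s`, the program `p` halts in state `s'` after exactly `t`
steps. Every elementary instruction and every test of a branch or of a loop is one step. -/
inductive Exec : Prog → State → ℕ → State → Prop
  | skip (s : State) : Exec .skip s 1 s
  | const (d k : ℕ) (s : State) : Exec (.const d k) s 1 (s.setReg d k)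
  | add (d a b : ℕ) (s : State) : Exec (.add d a b) s 1 (s.setReg d (s.reg a + s.reg b))
  | sub (d a b : ℕ) (s : State) : Exec (.sub d a b) s 1 (s.setReg d (s.reg a - s.reg b))
  | load (d a : ℕ) (s : State) : Exec (.load d a) s 1 (s.setReg d (s.mem (s.reg a)))
  | store (a b : ℕ) (s : State) : Exec (.store a b) s 1 (s.setMem (s.reg a) (s.reg b))
  | seq {p q : Prog} {s s' s'' : State} {t t' : ℕ} :
      Exec p s t s' → Exec q s' t' s'' → Exec (.seq p q) s (t + t') s''
  | ite_true {a : ℕ} {p q : Prog} {s s' : State} {t : ℕ} :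
      s.reg a ≠ 0 → Exec p s t s' → Exec (.ite a p q) s (t + 1) s'
  | ite_false {a : ℕ} {p q : Prog} {s s' : State} {t : ℕ} :
      s.reg a = 0 → Exec q s t s' → Exec (.ite a p q) s (t + 1) s'
  | loop_true {a : ℕ} {p : Prog} {s s' s'' : State} {t t' : ℕ} :
      s.reg a ≠ 0 → Exec p s t s' → Exec (.loop a p) s' t' s'' →
        Exec (.loop a p) s (t + t' + 1) s''
  | loop_false {a : ℕ} {p : Prog} {s : State} :
      s.reg a = 0 → Exec (.loop a p) s 1 s

open Classical in
/-- The initial state for the input `G`: register `0` holds the number `n` of vertices, the first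
`n²` memory cells hold the adjacency matrix of `G` row by row, and everything else is `0`. -/
noncomputable def graphInput {n : ℕ} (G : SimpleGraph (Fin n)) : State where
  reg := fun r => if r = 0 then n else 0
  mem := fun k => if ∃ i j : Fin n, k = (i : ℕ) * n + j ∧ G.Adj i j then 1 else 0

/-- Started on `G`, the program `p` halts after exactly `t` steps with the correct answer to the
question whether `G` is 3-colourable: `1` (yes) or `0` (no) in register `0`. -/
def DecidesThreeColoring {n : ℕ} (p : Prog) (G : SimpleGraph (Fin n)) (t : ℕ) : Prop :=
  ∃ s : State, Exec p (graphInput G) t s ∧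
    (G.Colorable 3 → s.reg 0 = 1) ∧ (¬ G.Colorable 3 → s.reg 0 = 0)

end RAM

/-! In a graph of diameter two every neighbourhood dominates: a vertex that is neither the centre
nor adjacent to it shares a neighbour with it. A vertex of minimum degree thus yields a dominating
set of at most δ vertices. The greedy choice among all vertices yields another: by averaging, each
round covers at least the fraction δ/n of what is still uncovered, so about (n/δ) log δ rounds leave
at most n/δ vertices, each costing at most one further round. The algorithm runs the greedy choice
inside every neighbourhood and inside the whole vertex set and keeps a shortest list; its length k
obeys both bounds (`le_of_greedy`).

All 3^k colourings of this list are then tried. Each of them deprives every vertex of at least one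
colour, so extending it is a problem of 2-SAT type. It is decided by closing the forbidden pairs of
literals under path consistency, which is complete for lists of two colours
(`exists_coloring_of_closed`, `exists_coloring_iff`).

On the machine, `Comp` is a class of functions computable in time polynomial in the largest input.
It is closed under composition and bounded sums, hence under bounded quantifiers and search.
Recursion is expressed by tables in memory, each entry depending on earlier ones (`exists_fill`).
The total time is polynomial in (n + 2) 3^k (`exists_program`). If δ ≥ log n, the polynomial factor
is absorbed, because log n ≤ 2 (n/δ) log δ (`logb_le_two_mul`). -/

namespace RAM

/-! ### Time-bounded program logic -/

/-- `p`, started in `s`, halts within `T` steps in a state satisfying `Q`. -/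
def Runs (p : Prog) (s : State) (T : ℕ) (Q : State → Prop) : Prop :=
  ∃ t s', Exec p s t s' ∧ t ≤ T ∧ Q s'

namespace Runs

variable {p q : Prog} {s : State} {T T' : ℕ} {Q R : State → Prop}

theorem mono (h : Runs p s T Q) (hT : T ≤ T') (hQ : ∀ s', Q s' → R s') : Runs p s T' R := by
  obtain ⟨t, s', h1, h2, h3⟩ := h
  exact ⟨t, s', h1, h2.trans hT, hQ _ h3⟩

theorem seq (h : Runs p s T Q) (h' : ∀ s', Q s' → Runs q s' T' R) :
    Runs (.seq p q) s (T + T') R := by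
  obtain ⟨t, s', h1, h2, h3⟩ := h
  obtain ⟨t', s'', h4, h5, h6⟩ := h' s' h3
  exact ⟨t + t', s'', .seq h1 h4, by omega, h6⟩

theorem const {d k : ℕ} (h : Q (s.setReg d k)) : Runs (.const d k) s 1 Q :=
  ⟨1, _, .const d k s, le_rfl, h⟩

theorem add {d a b : ℕ} (h : Q (s.setReg d (s.reg a + s.reg b))) : Runs (.add d a b) s 1 Q :=
  ⟨1, _, .add d a b s, le_rfl, h⟩

theorem sub {d a b : ℕ} (h : Q (s.setReg d (s.reg a - s.reg b))) : Runs (.sub d a b) s 1 Q :=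
  ⟨1, _, .sub d a b s, le_rfl, h⟩

theorem load {d a : ℕ} (h : Q (s.setReg d (s.mem (s.reg a)))) : Runs (.load d a) s 1 Q :=
  ⟨1, _, .load d a s, le_rfl, h⟩

theorem store {a b : ℕ} (h : Q (s.setMem (s.reg a) (s.reg b))) : Runs (.store a b) s 1 Q :=
  ⟨1, _, .store a b s, le_rfl, h⟩

theorem ite {a : ℕ} (h : s.reg a ≠ 0 → Runs p s T Q) (h' : s.reg a = 0 → Runs q s T' Q) :
    Runs (.ite a p q) s (T + T' + 1) Q := by
  by_cases ha : s.reg a = 0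
  · obtain ⟨t, s', h1, h2, h3⟩ := h' ha
    exact ⟨t + 1, s', .ite_false ha h1, by omega, h3⟩
  · obtain ⟨t, s', h1, h2, h3⟩ := h ha
    exact ⟨t + 1, s', .ite_true ha h1, by omega, h3⟩

/-- A loop whose test register counts down from `N`, with invariant `I`. -/
theorem loop {a : ℕ} {N : ℕ} (I : ℕ → State → Prop) (h0 : I 0 s) (hN : s.reg a = N)
    (h : ∀ i < N, ∀ s, s.reg a = N - i → I i s →
      Runs p s T (fun s' => s'.reg a = N - (i + 1) ∧ I (i + 1) s')) :
    Runs (.loop a p) s (N * (T + 1) + 1) (I N) := by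
  have key : ∀ j ≤ N, ∀ s, s.reg a = j → I (N - j) s →
      Runs (.loop a p) s (j * (T + 1) + 1) (I N) := by
    intro j
    induction j with
    | zero => exact fun _ s hs hI => ⟨1, s, .loop_false hs, by omega, by simpa using hI⟩
    | succ j ih =>
      intro hj s hs hI
      obtain ⟨t, s', h1, h2, h3, h4⟩ := h (N - (j + 1)) (by omega) s (by omega) hI
      obtain ⟨t', s'', h5, h6, h7⟩ := ih (by omega) s' (by omega)
        (by convert h4 using 1; omega)
      exact ⟨t + t' + 1, s'', .loop_true (by omega) h1 h5, by linarith, h7⟩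
  exact key N le_rfl s hN (by simpa using h0)

end Runs

/-! ### Polynomially computable functions -/

/-- Extend a list of variables at the front. -/
def cons (i : ℕ) (a : ℕ → ℕ) : ℕ → ℕ
  | 0 => i
  | k + 1 => a k

/-- `p` computes `F` of the memory and of the registers `l 0, l 1, …` into register `d`, without
changing the memory and the registers below `d`; if all inputs are at most `M`, then running time
and value are at most `M ^ K`. -/
def Computes (F : (ℕ → ℕ) → (ℕ → ℕ) → ℕ) (l : ℕ → ℕ) (d : ℕ) (p : Prog) (K : ℕ) : Prop :=
  ∀ s M, 2 ≤ M → (∀ i, s.reg (l i) ≤ M) → (∀ k, s.mem k ≤ M) →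
    F s.mem (fun i => s.reg (l i)) ≤ M ^ K ∧
    Runs p s (M ^ K) (fun s' => s'.mem = s.mem ∧ (∀ r < d, s'.reg r = s.reg r) ∧
      s'.reg d = F s.mem (fun i => s.reg (l i)))

/-- Functions of the memory and of a list of variables which the machine computes in time
polynomial in the largest input. -/
def Comp (F : (ℕ → ℕ) → (ℕ → ℕ) → ℕ) : Prop :=
  ∀ (l : ℕ → ℕ) (d : ℕ), (∀ i, l i < d) → ∃ p K, Computes F l d p K

/-- The factor 2 is absorbed by one more power of `M`. Time bounds thus keep the form `M ^ K` when
programs are composed. -/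
theorem pow_add_pow_le {M : ℕ} (hM : 2 ≤ M) (a b : ℕ) : M ^ a + M ^ b ≤ M ^ (a + b + 1) := by
  have h1 : M ^ a ≤ M ^ (a + b) := Nat.pow_le_pow_right (by omega) (by omega)
  have h2 : M ^ b ≤ M ^ (a + b) := Nat.pow_le_pow_right (by omega) (by omega)
  calc M ^ a + M ^ b ≤ M ^ (a + b) * 2 := by omega
    _ ≤ M ^ (a + b) * M := Nat.mul_le_mul_left _ hM
    _ = _ := (pow_succ _ _).symm

theorem le_pow_self_of_two_le {M : ℕ} (hM : 2 ≤ M) (c : ℕ) : c ≤ M ^ c :=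
  (Nat.lt_pow_self (by omega)).le

namespace Comp

variable {F G H : (ℕ → ℕ) → (ℕ → ℕ) → ℕ}

theorem var (k : ℕ) : Comp fun _ a => a k := by
  intro l d hl
  -- With no move instruction available, a register is copied by adding zero; the two steps are at
  -- most `M ^ 1`.
  refine ⟨.seq (.const d 0) (.add d (l k) d), 1, fun s M hM hs hm => ⟨by simpa using hs k, ?_⟩⟩
  refine ((Runs.const (Q := fun s' => s' = s.setReg d 0) rfl).seq (T' := 1) ?_).mono
    (by simpa using hM) (fun _ h => h)
  rintro _ rfl
  have := hl k
  refine Runs.add ⟨rfl, fun r hr => ?_, ?_⟩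
  · simp [State.setReg, hr.ne]
  · simp [State.setReg, this.ne]

theorem const (c : ℕ) : Comp fun _ _ => c := by
  intro l d hl
  refine ⟨.const d c, c, fun s M hM hs hm => ⟨le_pow_self_of_two_le hM c, ?_⟩⟩
  refine (Runs.const (d := d) (k := c) ⟨rfl, fun r hr => ?_, ?_⟩).mono
    (Nat.one_le_pow _ _ (by omega)) (fun _ h => h)
  · simp [State.setReg, hr.ne]
  · simp [State.setReg]

/-- The second operand is computed into register `d + 1`, so that the first one in `d` survives. -/
theorem add (hF : Comp F) (hG : Comp G) : Comp fun m a => F m a + G m a := by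
  intro l d hl
  obtain ⟨p, K, hp⟩ := hF l d hl
  obtain ⟨q, K', hq⟩ := hG l (d + 1) (fun i => (hl i).trans (by omega))
  refine ⟨.seq p (.seq q (.add d d (d + 1))), K + K' + 2, fun s M hM hs hm => ?_⟩
  obtain ⟨h1, h2⟩ := hp s M hM hs hm
  have hle := pow_add_pow_le hM K K'
  have hle' : M ^ (K + K' + 1) + 1 ≤ M ^ (K + K' + 2) := by
    have := pow_add_pow_le hM (K + K' + 1) 0
    simpa using this
  refine ⟨?_, ?_⟩
  · have := (hq s M hM hs hm).1
    dsimp only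
    omega
  refine (h2.seq (T' := M ^ K' + 1) ?_).mono (by omega) (fun _ h => h)
  rintro s1 ⟨hm1, hr1, hd1⟩
  have hl1 : ∀ i, s1.reg (l i) = s.reg (l i) := fun i => hr1 _ (hl i)
  obtain ⟨h3, h4⟩ := hq s1 M hM (fun i => by rw [hl1]; exact hs i) (by rw [hm1]; exact hm)
  refine h4.seq ?_
  rintro s2 ⟨hm2, hr2, hd2⟩
  refine Runs.add ⟨?_, fun r hr => ?_, ?_⟩
  · simp [State.setReg, hm2, hm1]
  · simp [State.setReg, hr.ne, hr2 r (by omega), hr1 r hr]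
  · simp [State.setReg, hr2 d (by omega), hd1, hd2, hm1, hl1]

theorem sub (hF : Comp F) (hG : Comp G) : Comp fun m a => F m a - G m a := by
  intro l d hl
  obtain ⟨p, K, hp⟩ := hF l d hl
  obtain ⟨q, K', hq⟩ := hG l (d + 1) (fun i => (hl i).trans (by omega))
  refine ⟨.seq p (.seq q (.sub d d (d + 1))), K + K' + 2, fun s M hM hs hm => ?_⟩
  obtain ⟨h1, h2⟩ := hp s M hM hs hm
  have hle := pow_add_pow_le hM K K'
  have hle' : M ^ (K + K' + 1) + 1 ≤ M ^ (K + K' + 2) := by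
    have := pow_add_pow_le hM (K + K' + 1) 0
    simpa using this
  refine ⟨?_, ?_⟩
  · have := (hq s M hM hs hm).1
    dsimp only
    omega
  refine (h2.seq (T' := M ^ K' + 1) ?_).mono (by omega) (fun _ h => h)
  rintro s1 ⟨hm1, hr1, hd1⟩
  have hl1 : ∀ i, s1.reg (l i) = s.reg (l i) := fun i => hr1 _ (hl i)
  obtain ⟨h3, h4⟩ := hq s1 M hM (fun i => by rw [hl1]; exact hs i) (by rw [hm1]; exact hm)
  refine h4.seq ?_
  rintro s2 ⟨hm2, hr2, hd2⟩
  refine Runs.sub ⟨?_, fun r hr => ?_, ?_⟩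
  · simp [State.setReg, hm2, hm1]
  · simp [State.setReg, hr.ne, hr2 r (by omega), hr1 r hr]
  · simp [State.setReg, hr2 d (by omega), hd1, hd2, hm1, hl1]

theorem load (hF : Comp F) : Comp fun m a => m (F m a) := by
  intro l d hl
  obtain ⟨p, K, hp⟩ := hF l d hl
  refine ⟨.seq p (.load d d), K + 1, fun s M hM hs hm => ?_⟩
  obtain ⟨h1, h2⟩ := hp s M hM hs hm
  have hle : M ^ K + 1 ≤ M ^ (K + 1) := by simpa using pow_add_pow_le hM K 0
  refine ⟨(hm _).trans ?_, ?_⟩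
  · exact Nat.le_self_pow (by omega) _
  refine (h2.seq (T' := 1) ?_).mono hle (fun _ h => h)
  rintro s1 ⟨hm1, hr1, hd1⟩
  refine Runs.load ⟨?_, fun r hr => ?_, ?_⟩
  · simp [State.setReg, hm1]
  · simp [State.setReg, hr.ne, hr1 r hr]
  · simp [State.setReg, hd1, hm1]

theorem ite (hH : Comp H) (hF : Comp F) (hG : Comp G) :
    Comp fun m a => if H m a = 0 then G m a else F m a := by
  intro l d hl
  obtain ⟨o, K₀, ho⟩ := hH l d hl
  obtain ⟨p, K, hp⟩ := hF l d hl
  obtain ⟨q, K', hq⟩ := hG l d hl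
  refine ⟨.seq o (.ite d p q), K₀ + (K + K' + 2) + 1, fun s M hM hs hm => ?_⟩
  obtain ⟨h1, h2⟩ := ho s M hM hs hm
  have hle := pow_add_pow_le hM K K'
  have hle' : M ^ (K + K' + 1) + 1 ≤ M ^ (K + K' + 2) := by
    have := pow_add_pow_le hM (K + K' + 1) 0
    simpa using this
  have hle3 := pow_add_pow_le hM K₀ (K + K' + 2)
  refine ⟨?_, ?_⟩
  · have h3 := (hp s M hM hs hm).1
    have h4 := (hq s M hM hs hm).1
    dsimp only
    split_ifs <;> omega
  refine (h2.seq (T' := M ^ K + M ^ K' + 1) ?_).mono (by omega) (fun _ h => h)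
  rintro s1 ⟨hm1, hr1, hd1⟩
  have hl1 : ∀ i, s1.reg (l i) = s.reg (l i) := fun i => hr1 _ (hl i)
  have hs1 : ∀ i, s1.reg (l i) ≤ M := fun i => by rw [hl1]; exact hs i
  have hmm1 : ∀ k, s1.mem k ≤ M := by rw [hm1]; exact hm
  refine Runs.ite (fun h => ?_) (fun h => ?_)
  · refine (hp s1 M hM hs1 hmm1).2.mono le_rfl ?_
    rintro s2 ⟨hm2, hr2, hd2⟩
    rw [hd1] at h
    exact ⟨hm2.trans hm1, fun r hr => (hr2 r hr).trans (hr1 r hr), by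
      simp only [hd2, hl1, hm1, h, if_false]⟩
  · refine (hq s1 M hM hs1 hmm1).2.mono le_rfl ?_
    rintro s2 ⟨hm2, hr2, hd2⟩
    rw [hd1] at h
    exact ⟨hm2.trans hm1, fun r hr => (hr2 r hr).trans (hr1 r hr), by
      simp only [hd2, hl1, hm1, h, if_true]⟩

theorem reindex (hF : Comp F) (σ : ℕ → ℕ) : Comp fun m a => F m (fun i => a (σ i)) :=
  fun l d hl => by
  obtain ⟨p, K, h⟩ := hF (fun i => l (σ i)) d (fun i => hl _)
  exact ⟨p, K, fun s M hM hs hm => h s M hM (fun i => hs _) hm⟩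

theorem cons_comp_reg (s : State) (l : ℕ → ℕ) (r : ℕ) :
    (fun i => s.reg (cons r l i)) = cons (s.reg r) (fun i => s.reg (l i)) := by
  funext i
  cases i <;> rfl

/-- This is composition: register `d` keeps the value of `G` and serves as the new front variable
while `F` is computed into `d + 1`. The inputs of `F` are only bounded by `M ^ (K' + 1)`, hence the
exponent `(K' + 1) * K`. -/
theorem letIn (hF : Comp F) (hG : Comp G) : Comp fun m a => F m (cons (G m a) a) := by
  intro l d hl
  obtain ⟨q, K', hq⟩ := hG l d hl
  obtain ⟨p, K, hp⟩ := hF (cons d l) (d + 1) (by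
    rintro (_ | i)
    · exact Nat.lt_succ_self d
    · exact (hl i).trans (Nat.lt_succ_self d))
  refine ⟨.seq q (.seq p (.seq (.const d 0) (.add d d (d + 1)))), K' + ((K' + 1) * K + 1 + 1) + 1,
    fun s M hM hs hm => ?_⟩
  obtain ⟨h1, h2⟩ := hq s M hM hs hm
  have hle1 := pow_add_pow_le hM ((K' + 1) * K) 1
  have hle2 := pow_add_pow_le hM K' ((K' + 1) * K + 1 + 1)
  have hM1 : M ≤ M ^ (K' + 1) := Nat.le_self_pow (by omega) _
  have hM2 : M ^ K' ≤ M ^ (K' + 1) := Nat.pow_le_pow_right (by omega) (by omega)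
  rw [pow_one] at hle1
  have hs1 : ∀ s1 : State, (∀ r < d, s1.reg r = s.reg r) →
      s1.reg d = G s.mem (fun i => s.reg (l i)) → ∀ i, s1.reg (cons d l i) ≤ M ^ (K' + 1) := by
    rintro s1 h3 h4 (_ | i)
    · exact h4.trans_le (h1.trans hM2)
    · exact (h3 _ (hl i)).trans_le ((hs i).trans hM1)
  have henv : ∀ s1 : State, (∀ r < d, s1.reg r = s.reg r) →
      s1.reg d = G s.mem (fun i => s.reg (l i)) → (fun i => s1.reg (cons d l i)) =
      cons (G s.mem (fun i => s.reg (l i))) (fun i => s.reg (l i)) := by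
    intro s1 h3 h4
    rw [cons_comp_reg, h4]
    congr 1
    funext i
    exact h3 _ (hl i)
  refine ⟨?_, ?_⟩
  -- The bound on the value of `F` speaks of a state that holds the value of `G` in a register; the
  -- state reached by the first program is one.
  · obtain ⟨_, s1, -, -, hm1, hr1, hd1⟩ := h2
    have h3 := (hp s1 (M ^ (K' + 1)) (hM.trans hM1) (hs1 s1 hr1 hd1)
      (by rw [hm1]; exact fun k => (hm k).trans hM1)).1
    rw [henv s1 hr1 hd1, hm1, ← pow_mul] at h3
    dsimp only
    omega
  refine (h2.seq (T' := M ^ ((K' + 1) * K) + 2) ?_).mono (by omega) (fun _ h => h)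
  rintro s1 ⟨hm1, hr1, hd1⟩
  have h4 := (hp s1 (M ^ (K' + 1)) (hM.trans hM1) (hs1 s1 hr1 hd1)
      (by rw [hm1]; exact fun k => (hm k).trans hM1)).2
  rw [← pow_mul] at h4
  refine h4.seq ?_
  rintro s2 ⟨hm2, hr2, hd2⟩
  refine Runs.seq (T := 1) (T' := 1) (Runs.const (Q := fun s' => s' = s2.setReg d 0) rfl) ?_
  rintro _ rfl
  refine Runs.add ⟨?_, fun r hr => ?_, ?_⟩
  · simp [State.setReg, hm2, hm1]
  · simp [State.setReg, hr.ne, hr2 r (by omega), hr1 r hr]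
  · simp [State.setReg, hd2, hm1, henv s1 hr1 hd1]

/-- Register `d` accumulates, `d + 1` counts down from the bound, `d + 2` is the summation index,
and `d + 3` holds the term and then the constant 1. -/
theorem sum {B : (ℕ → ℕ) → (ℕ → ℕ) → ℕ} {F : (ℕ → ℕ) → ℕ → (ℕ → ℕ) → ℕ} (hB : Comp B)
    (hF : Comp fun m a => F m (a 0) (fun i => a (i + 1))) :
    Comp fun m a => ∑ i ∈ Finset.range (B m a), F m i a := by
  intro l d hl
  obtain ⟨q, K', hq⟩ := hB l (d + 1) (fun i => (hl i).trans (by omega))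
  obtain ⟨p, K, hp⟩ := hF (cons (d + 2) l) (d + 3) (by
    rintro (_ | i)
    · exact Nat.lt_succ_self _
    · exact (hl i).trans (by omega))
  refine ⟨.seq (.const d 0) (.seq q (.seq (.const (d + 2) 0) (.loop (d + 1) (.seq p (.seq
    (.add d d (d + 3)) (.seq (.const (d + 3) 1) (.seq (.add (d + 2) (d + 2) (d + 3))
    (.sub (d + 1) (d + 1) (d + 3))))))))),
    K' + (K' + ((K' + 1) * K + 3 + 1) + 2 + 1) + 1, fun s M hM hs hm => ?_⟩
  have hM1 : M ≤ M ^ (K' + 1) := Nat.le_self_pow (by omega) _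
  have hM2 : M ^ K' ≤ M ^ (K' + 1) := Nat.pow_le_pow_right (by omega) (by omega)
  set B₀ := B s.mem (fun i => s.reg (l i)) with hB₀
  set f : ℕ → ℕ := fun i => F s.mem i (fun i => s.reg (l i)) with hf
  have hBle : B₀ ≤ M ^ K' := (hq s M hM hs hm).1
  have hbody : ∀ i < B₀, ∀ s1 : State, s1.mem = s.mem → (∀ r < d, s1.reg r = s.reg r) →
      s1.reg (d + 2) = i → f i ≤ M ^ ((K' + 1) * K) ∧ Runs p s1 (M ^ ((K' + 1) * K)) (fun s' =>
      s'.mem = s.mem ∧ (∀ r < d + 3, s'.reg r = s1.reg r) ∧ s'.reg (d + 3) = f i) := by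
    intro i hi s1 hm1 hr1 hi1
    have h3 := hp s1 (M ^ (K' + 1)) (hM.trans hM1) (by
      rintro (_ | j)
      · change s1.reg (d + 2) ≤ _
        omega
      · exact (hr1 _ (hl j)).trans_le ((hs j).trans hM1))
      (by rw [hm1]; exact fun k => (hm k).trans hM1)
    have h4 : F s1.mem (s1.reg (cons (d + 2) l 0)) (fun i => s1.reg (cons (d + 2) l (i + 1))) =
        f i := by
      change F s1.mem (s1.reg (d + 2)) (fun i => s1.reg (l i)) = _
      rw [hm1, hi1, hf]
      congr 1
      funext j
      exact hr1 _ (hl j)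
    dsimp only at h3
    rw [← pow_mul, h4, hm1] at h3
    exact h3
  have hfle : ∀ i < B₀, f i ≤ M ^ ((K' + 1) * K) := by
    intro i hi
    refine (hbody i hi (s.setReg (d + 2) i) rfl (fun r hr => ?_) ?_).1
    · simp [State.setReg, (show r ≠ d + 2 by omega)]
    · simp [State.setReg]
  have e1 : M ^ ((K' + 1) * K) + 5 ≤ M ^ ((K' + 1) * K + 3 + 1) := by
    have := pow_add_pow_le hM ((K' + 1) * K) 3
    have h8 : 2 ^ 3 ≤ M ^ 3 := Nat.pow_le_pow_left hM 3
    omega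
  have e2 : B₀ * M ^ ((K' + 1) * K + 3 + 1) ≤ M ^ (K' + ((K' + 1) * K + 3 + 1)) := by
    rw [pow_add M K']
    exact Nat.mul_le_mul_right _ hBle
  have e3 : M ^ (K' + ((K' + 1) * K + 3 + 1)) + 3 ≤ M ^ (K' + ((K' + 1) * K + 3 + 1) + 2 + 1) := by
    have := pow_add_pow_le hM (K' + ((K' + 1) * K + 3 + 1)) 2
    have h8 : 2 ^ 2 ≤ M ^ 2 := Nat.pow_le_pow_left hM 2
    omega
  have e4 := pow_add_pow_le hM K' (K' + ((K' + 1) * K + 3 + 1) + 2 + 1)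
  refine ⟨?_, ?_⟩
  · have : ∑ i ∈ Finset.range B₀, f i ≤ B₀ * M ^ ((K' + 1) * K + 3 + 1) := by
      refine (Finset.sum_le_card_nsmul _ _ (M ^ ((K' + 1) * K + 3 + 1)) ?_).trans (by simp)
      intro i hi
      have := hfle i (Finset.mem_range.1 hi)
      omega
    change ∑ i ∈ Finset.range B₀, f i ≤ _
    omega
  refine Runs.mono (Runs.seq (T := 1) (T' := M ^ K' + (1 + (B₀ * ((M ^ ((K' + 1) * K) + 4) + 1) + 1)))
    (Runs.const (Q := fun s' => s' = s.setReg d 0) rfl) ?_) ?_ (fun _ h => h)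
  swap
  · have : B₀ * (M ^ ((K' + 1) * K) + 4 + 1) ≤ B₀ * M ^ ((K' + 1) * K + 3 + 1) :=
      Nat.mul_le_mul_left _ e1
    omega
  rintro _ rfl
  have hreg0 : ∀ i, (s.setReg d 0).reg (l i) = s.reg (l i) := fun i => by
    simp [State.setReg, (hl i).ne]
  refine Runs.seq (hq (s.setReg d 0) M hM (fun i => by rw [hreg0]; exact hs i) hm).2 ?_
  rintro s1 ⟨hm1, hr1, hd1⟩
  simp only [hreg0] at hd1
  refine Runs.seq (Runs.const (Q := fun s' => s' = s1.setReg (d + 2) 0) rfl) ?_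
  rintro _ rfl
  refine (Runs.loop (N := B₀) (fun i s' => s'.mem = s.mem ∧ (∀ r < d, s'.reg r = s.reg r) ∧
    s'.reg (d + 2) = i ∧ s'.reg d = ∑ j ∈ Finset.range i, f j) ?_ ?_ ?_).mono le_rfl
    (fun s' h => ⟨h.1, h.2.1, h.2.2.2⟩)
  · refine ⟨hm1, fun r hr => ?_, ?_, ?_⟩
    · simp [State.setReg, (show r ≠ d + 2 by omega), hr1 r (by omega), hr.ne]
    · simp [State.setReg]
    · simp [State.setReg, hr1 d (by omega)]
  · simp only [State.setReg]
    rw [Function.update_of_ne (by omega), hd1]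
    rfl
  · rintro i hi s2 hc ⟨hm2, hr2, hi2, hd2⟩
    refine (hbody i hi s2 hm2 hr2 hi2).2.seq (T' := 1 + (1 + (1 + 1))) ?_
    rintro s3 ⟨hm3, hr3, hd3⟩
    refine Runs.seq (Runs.add (Q := fun s' => s' = _) rfl) ?_
    rintro _ rfl
    refine Runs.seq (Runs.const (Q := fun s' => s' = _) rfl) ?_
    rintro _ rfl
    refine Runs.seq (Runs.add (Q := fun s' => s' = _) rfl) ?_
    rintro _ rfl
    refine Runs.sub ⟨?_, ?_, fun r hr => ?_, ?_, ?_⟩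
    · simp [State.setReg, hr3 (d + 1) (by omega), hc]
      omega
    · simpa [State.setReg] using hm3
    · simp [State.setReg, (show r ≠ d + 2 by omega), (show r ≠ d + 1 by omega),
        (show r ≠ d + 3 by omega), hr.ne, hr3 r (by omega), hr2 r hr]
    · simp [State.setReg, hr3 (d + 2) (by omega), hi2]
    · simp [State.setReg, hr3 d (by omega), hd2, hd3, Finset.sum_range_succ]

theorem of_eq (hF : Comp F) (h : ∀ m a, F m a = G m a) : Comp G := by
  rwa [← show F = G from funext fun m => funext (h m)]

theorem comp₁ {f : (ℕ → ℕ) → ℕ → ℕ} (hf : Comp fun m a => f m (a 0)) (hF : Comp F) :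
    Comp fun m a => f m (F m a) :=
  letIn hf hF

/-- The last argument is pushed to the front first, so earlier arguments are reindexed to skip what
already lies there. -/
theorem comp₂ {f : (ℕ → ℕ) → ℕ → ℕ → ℕ} (hf : Comp fun m a => f m (a 0) (a 1)) (hF : Comp F)
    (hG : Comp G) : Comp fun m a => f m (F m a) (G m a) :=
  letIn (letIn hf (hF.reindex (· + 1))) hG

theorem comp₃ {f : (ℕ → ℕ) → ℕ → ℕ → ℕ → ℕ} (hf : Comp fun m a => f m (a 0) (a 1) (a 2))
    (hF : Comp F) (hG : Comp G) (hH : Comp H) : Comp fun m a => f m (F m a) (G m a) (H m a) :=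
  letIn (letIn (letIn hf (hF.reindex (· + 2))) (hG.reindex (· + 1))) hH

theorem comp₄ {f : (ℕ → ℕ) → ℕ → ℕ → ℕ → ℕ → ℕ}
    (hf : Comp fun m a => f m (a 0) (a 1) (a 2) (a 3)) {I : (ℕ → ℕ) → (ℕ → ℕ) → ℕ}
    (hF : Comp F) (hG : Comp G) (hH : Comp H) (hI : Comp I) :
    Comp fun m a => f m (F m a) (G m a) (H m a) (I m a) :=
  letIn (letIn (letIn (letIn hf (hF.reindex (· + 3))) (hG.reindex (· + 2))) (hH.reindex (· + 1))) hI

theorem comp₅ {f : (ℕ → ℕ) → ℕ → ℕ → ℕ → ℕ → ℕ → ℕ}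
    (hf : Comp fun m a => f m (a 0) (a 1) (a 2) (a 3) (a 4)) {I J : (ℕ → ℕ) → (ℕ → ℕ) → ℕ}
    (hF : Comp F) (hG : Comp G) (hH : Comp H) (hI : Comp I) (hJ : Comp J) :
    Comp fun m a => f m (F m a) (G m a) (H m a) (I m a) (J m a) :=
  letIn (letIn (letIn (letIn (letIn hf (hF.reindex (· + 4))) (hG.reindex (· + 3)))
    (hH.reindex (· + 2))) (hI.reindex (· + 1))) hJ

theorem mul (hF : Comp F) (hG : Comp G) : Comp fun m a => F m a * G m a :=
  (sum (F := fun m _ a => G m a) hF (hG.reindex (· + 1))).of_eq (by simp)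

end Comp

/-! ### Polynomially decidable predicates -/

open Classical in
/-- The indicator of a proposition. -/
noncomputable def ind (p : Prop) : ℕ := if p then 1 else 0

theorem ind_of_true {p : Prop} (h : p) : ind p = 1 := if_pos h

theorem ind_of_false {p : Prop} (h : ¬ p) : ind p = 0 := if_neg h

theorem ind_le_one (p : Prop) : ind p ≤ 1 := by
  by_cases h : p <;> simp [ind, h]

theorem ind_ne_zero {p : Prop} : ind p ≠ 0 ↔ p := by
  by_cases h : p <;> simp [ind, h]

theorem sum_ind (p : ℕ → Prop) [DecidablePred p] (n : ℕ) :
    ∑ i ∈ Finset.range n, ind (p i) = ((Finset.range n).filter p).card := by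
  rw [Finset.card_filter]
  refine Finset.sum_congr rfl fun i _ => ?_
  by_cases h : p i <;> simp [ind, h]

/-- Decidable in time polynomial in the largest input. -/
def CompP (P : (ℕ → ℕ) → (ℕ → ℕ) → Prop) : Prop := Comp fun m a => ind (P m a)

namespace CompP

variable {P Q : (ℕ → ℕ) → (ℕ → ℕ) → Prop} {F G : (ℕ → ℕ) → (ℕ → ℕ) → ℕ}

theorem of_iff (hP : CompP P) (h : ∀ m a, P m a ↔ Q m a) : CompP Q := by
  rwa [← show P = Q from funext fun m => funext fun a => propext (h m a)]

theorem ne_zero (hF : Comp F) : CompP fun m a => F m a ≠ 0 :=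
  (hF.ite (.const 1) (.const 0)).of_eq fun m a => by
    by_cases h : F m a = 0 <;> simp [h, ind]

theorem ite {_ : ∀ m a, Decidable (P m a)} (hP : CompP P) (hF : Comp F) (hG : Comp G) :
    Comp fun m a => if P m a then F m a else G m a :=
  (Comp.ite hP hF hG).of_eq fun m a => by by_cases h : P m a <;> simp [h, ind]

theorem reindex (hP : CompP P) (σ : ℕ → ℕ) : CompP fun m a => P m (fun i => a (σ i)) :=
  Comp.reindex hP σ

theorem not (hP : CompP P) : CompP fun m a => ¬ P m a :=
  (Comp.ite hP (.const 0) (.const 1)).of_eq fun m a => by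
    by_cases h : P m a <;> simp [h, ind]

theorem and (hP : CompP P) (hQ : CompP Q) : CompP fun m a => P m a ∧ Q m a :=
  (Comp.mul hP hQ).of_eq fun m a => by
    by_cases h : P m a <;> by_cases h' : Q m a <;> simp [h, h', ind]

theorem or (hP : CompP P) (hQ : CompP Q) : CompP fun m a => P m a ∨ Q m a :=
  (hP.not.and hQ.not).not.of_iff fun m a => by tauto

theorem imp (hP : CompP P) (hQ : CompP Q) : CompP fun m a => P m a → Q m a :=
  (hP.not.or hQ).of_iff fun m a => by tauto

theorem lt (hF : Comp F) (hG : Comp G) : CompP fun m a => F m a < G m a :=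
  (ne_zero (hG.sub hF)).of_iff fun m a => by omega

theorem le (hF : Comp F) (hG : Comp G) : CompP fun m a => F m a ≤ G m a :=
  (lt hG hF).not.of_iff fun m a => by omega

theorem eq (hF : Comp F) (hG : Comp G) : CompP fun m a => F m a = G m a :=
  ((le hF hG).and (le hG hF)).of_iff fun m a => by omega

theorem ne (hF : Comp F) (hG : Comp G) : CompP fun m a => F m a ≠ G m a := (eq hF hG).not

/-- A bounded search succeeds iff the sum of the indicators is nonzero. -/
theorem ex {B : (ℕ → ℕ) → (ℕ → ℕ) → ℕ} {P : (ℕ → ℕ) → ℕ → (ℕ → ℕ) → Prop} (hB : Comp B)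
    (hP : CompP fun m a => P m (a 0) (fun i => a (i + 1))) :
    CompP fun m a => ∃ i < B m a, P m i a :=
  (ne_zero (Comp.sum (F := fun m i a => ind (P m i a)) hB hP)).of_iff fun m a => by
    simp [ind]

theorem all {B : (ℕ → ℕ) → (ℕ → ℕ) → ℕ} {P : (ℕ → ℕ) → ℕ → (ℕ → ℕ) → Prop} (hB : Comp B)
    (hP : CompP fun m a => P m (a 0) (fun i => a (i + 1))) :
    CompP fun m a => ∀ i < B m a, P m i a :=
  (ex (P := fun m i a => ¬ P m i a) hB hP.not).not.of_iff fun m a => by push Not; rfl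

variable {H I : (ℕ → ℕ) → (ℕ → ℕ) → ℕ}

theorem comp₃ {p : (ℕ → ℕ) → ℕ → ℕ → ℕ → Prop} (hp : CompP fun m a => p m (a 0) (a 1) (a 2))
    (hF : Comp F) (hG : Comp G) (hH : Comp H) : CompP fun m a => p m (F m a) (G m a) (H m a) :=
  Comp.comp₃ (f := fun m i j k => ind (p m i j k)) hp hF hG hH

theorem comp₄ {p : (ℕ → ℕ) → ℕ → ℕ → ℕ → ℕ → Prop}
    (hp : CompP fun m a => p m (a 0) (a 1) (a 2) (a 3))
    (hF : Comp F) (hG : Comp G) (hH : Comp H) (hI : Comp I) :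
    CompP fun m a => p m (F m a) (G m a) (H m a) (I m a) :=
  Comp.comp₄ (f := fun m i j k l => ind (p m i j k l)) hp hF hG hH hI

end CompP

/-! ### Bounded minimization and division -/

/-- The least `i < n` with `p i`, and `n` if there is none. -/
noncomputable def first (n : ℕ) (p : ℕ → Prop) : ℕ :=
  ∑ v ∈ Finset.range n, ind (∀ u < v + 1, ¬ p u)

/-- The sum counts the `v < n` such that nothing up to `v` satisfies `p`; they form the initial
segment of length `i`. -/
theorem first_eq {n : ℕ} {p : ℕ → Prop} {i : ℕ} (hi : i ≤ n) (h : ∀ j < i, ¬ p j)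
    (hp : i = n ∨ p i) : first n p = i := by
  classical
  rw [first, sum_ind]
  have : (Finset.range n).filter (fun v => ∀ u < v + 1, ¬ p u) = Finset.range i := by
    ext v
    simp only [Finset.mem_filter, Finset.mem_range]
    constructor
    · rintro ⟨h1, h2⟩
      by_contra h3
      rcases hp with rfl | hp
      · exact h3 h1
      · exact h2 i (by omega) hp
    · exact fun h1 => ⟨by omega, fun u hu => h u (by omega)⟩
  rw [this, Finset.card_range]

theorem first_spec {n : ℕ} {p : ℕ → Prop} (h : ∃ i < n, p i) :
    first n p < n ∧ p (first n p) := by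
  classical
  have h' : ∃ i, p i := h.imp fun _ h => h.2
  obtain ⟨i, hi, hp⟩ := h
  have h1 := Nat.find_min' h' hp
  rw [first_eq (by omega) (fun j hj => Nat.find_min h' hj) (.inr (Nat.find_spec h'))]
  exact ⟨by omega, Nat.find_spec h'⟩

theorem first_le (n : ℕ) (p : ℕ → Prop) : first n p ≤ n := by
  refine (Finset.sum_le_card_nsmul _ _ 1 fun i _ => ind_le_one _).trans (by simp)

theorem Comp.first {B : (ℕ → ℕ) → (ℕ → ℕ) → ℕ} {P : (ℕ → ℕ) → ℕ → (ℕ → ℕ) → Prop} (hB : Comp B)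
    (hP : CompP fun m a => P m (a 0) (fun i => a (i + 1))) :
    Comp fun m a => first (B m a) (fun i => P m i a) := by
  refine Comp.sum (F := fun m v a => ind (∀ u < v + 1, ¬ P m u a)) hB ?_
  refine CompP.all (P := fun m u a => ¬ P m u (fun i => a (i + 1)))
    ((Comp.var 0).add (.const 1)) ?_
  -- Variable 1 is the `v` of the surrounding sum, which `P` does not see.
  exact (hP.reindex fun k => if k = 0 then 0 else k + 1).not.of_iff fun _ _ => by simp

/-- The quotient is the number of positive multiples of the divisor up to the dividend; the conjunct
`0 < G m a` yields the value 0 of a division by zero. -/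
theorem Comp.div {F G : (ℕ → ℕ) → (ℕ → ℕ) → ℕ} (hF : Comp F) (hG : Comp G) :
    Comp fun m a => F m a / G m a := by
  classical
  refine (Comp.sum (F := fun m v a => ind (0 < G m a ∧ (v + 1) * G m a ≤ F m a)) hF
    ((CompP.lt (.const 0) (hG.reindex (· + 1))).and
      (CompP.le (((Comp.var 0).add (.const 1)).mul (hG.reindex (· + 1)))
        (hF.reindex (· + 1))))).of_eq fun m a => ?_
  rw [sum_ind]
  rcases Nat.eq_zero_or_pos (G m a) with h | h
  · simp [h]
  · rw [← Finset.card_range (F m a / G m a)]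
    congr 1
    ext v
    have h1 : (v + 1) * G m a ≤ F m a ↔ v < F m a / G m a := (Nat.le_div_iff_mul_le h).symm
    have h2 := Nat.div_le_self (F m a) (G m a)
    simp only [Finset.mem_filter, Finset.mem_range, h, h1, true_and]
    omega

theorem Comp.mod {F G : (ℕ → ℕ) → (ℕ → ℕ) → ℕ} (hF : Comp F) (hG : Comp G) :
    Comp fun m a => F m a % G m a :=
  (hF.sub (hG.mul (hF.div hG))).of_eq fun _ _ => (Nat.mod_eq_sub_mul_div).symm

/-! ### Filling tables in memory -/

/-- A computable table can be appended to the memory, entry by entry, where each entry may depend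
on the previous ones. -/
theorem exists_fill {base size : (ℕ → ℕ) → ℕ → ℕ} {V : (ℕ → ℕ) → ℕ → ℕ → ℕ}
    (hbase : Comp fun m a => base m (a 0)) (hsize : Comp fun m a => size m (a 0))
    (hV : Comp fun m a => V m (a 1) (a 0)) :
    ∃ p K, ∀ (s : State) (M n : ℕ), 2 ≤ M → s.reg 0 = n → n ≤ M → (∀ k, s.mem k ≤ M) →
      (∀ i < size s.mem n, ∀ m m' : ℕ → ℕ, (∀ k < base s.mem n, m k = s.mem k) →
        (∀ k < base s.mem n, m' k = s.mem k) →
        (∀ j < i, m (base s.mem n + j) = m' (base s.mem n + j)) → V m n i = V m' n i) →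
      (∀ i < size s.mem n, ∀ m : ℕ → ℕ, (∀ k < base s.mem n, m k = s.mem k) →
        (∀ j < i, m (base s.mem n + j) = V m n j) → V m n i ≤ M) →
      Runs p s (M ^ K) (fun s' => s'.reg 0 = n ∧ (∀ k, s'.mem k ≤ M) ∧
        (∀ k < base s.mem n, s'.mem k = s.mem k) ∧
        ∀ i < size s.mem n, s'.mem (base s.mem n + i) = V s'.mem n i) := by
  obtain ⟨pb, Kb, hpb⟩ := hbase (fun _ => 0) 1 (by simp)
  obtain ⟨ps, Ks, hps⟩ := hsize (fun _ => 0) 2 (by simp)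
  -- Register 0 holds `n`, 1 the base, 2 the countdown, 3 the index, 4 the new entry, and 5 first
  -- the address and then the constant 1.
  obtain ⟨pv, Kv, hpv⟩ := hV (cons 3 fun _ => 0) 4 (by rintro (_ | i) <;> simp [cons])
  refine ⟨.seq pb (.seq ps (.seq (.const 3 0) (.loop 2 (.seq pv (.seq (.add 5 1 3) (.seq
    (.store 5 4) (.seq (.const 5 1) (.seq (.add 3 3 5) (.sub 2 2 5))))))))),
    Kb + (Ks + (Ks + (Ks + 1) * Kv + 6) + 1) + 1, fun s M n hM h0 hn hm hloc hbd => ?_⟩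
  have hM1 : M ≤ M ^ (Ks + 1) := Nat.le_self_pow (by omega) _
  have hM2 : M ^ Ks ≤ M ^ (Ks + 1) := Nat.pow_le_pow_right (by omega) (by omega)
  obtain ⟨-, hb⟩ := hpb s M hM (fun _ => h0.trans_le hn) hm
  have hsz := (hps s M hM (fun _ => h0.trans_le hn) hm).1
  simp only [h0] at hb hsz
  set b := base s.mem n with hbdef
  set N := size s.mem n with hN
  have e1 : M ^ ((Ks + 1) * Kv) + 6 ≤ M ^ ((Ks + 1) * Kv + 4) := by
    have := pow_add_pow_le hM ((Ks + 1) * Kv) 3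
    have h8 : 2 ^ 3 ≤ M ^ 3 := Nat.pow_le_pow_left hM 3
    rw [show (Ks + 1) * Kv + 3 + 1 = (Ks + 1) * Kv + 4 by ring] at this
    omega
  have e2 : N * M ^ ((Ks + 1) * Kv + 4) ≤ M ^ (Ks + ((Ks + 1) * Kv + 4)) := by
    rw [pow_add M Ks]
    exact Nat.mul_le_mul_right _ hsz
  have e3 : M ^ (Ks + ((Ks + 1) * Kv + 4)) + 2 ≤ M ^ (Ks + (Ks + 1) * Kv + 6) := by
    have := pow_add_pow_le hM (Ks + ((Ks + 1) * Kv + 4)) 1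
    rw [show Ks + ((Ks + 1) * Kv + 4) + 1 + 1 = Ks + (Ks + 1) * Kv + 6 by ring, pow_one] at this
    omega
  have e4 := pow_add_pow_le hM Ks (Ks + (Ks + 1) * Kv + 6)
  have e5 := pow_add_pow_le hM Kb (Ks + (Ks + (Ks + 1) * Kv + 6) + 1)
  have e6 : N * (M ^ ((Ks + 1) * Kv) + 5 + 1) ≤ N * M ^ ((Ks + 1) * Kv + 4) :=
    Nat.mul_le_mul_left _ e1
  refine Runs.mono (hb.seq (T' := M ^ Ks + (1 + (N * (M ^ ((Ks + 1) * Kv) + 5 + 1) + 1))) ?_)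
    (by omega) (fun _ h => h)
  rintro s1 ⟨hm1, hr1, hd1⟩
  have h01 : s1.reg 0 = n := (hr1 0 (by omega)).trans h0
  have hs1 := (hps s1 M hM (fun _ => h01.trans_le hn) (by rwa [hm1])).2
  simp only [h01, hm1] at hs1
  refine hs1.seq ?_
  rintro s2 ⟨hm2, hr2, hd2⟩
  refine Runs.seq (Runs.const (Q := fun s' => s' = s2.setReg 3 0) rfl) ?_
  rintro _ rfl
  refine (Runs.loop (N := N) (fun i s' => s'.reg 0 = n ∧ s'.reg 1 = b ∧ s'.reg 3 = i ∧
    (∀ k, s'.mem k ≤ M) ∧ (∀ k < b, s'.mem k = s.mem k) ∧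
    ∀ j < i, s'.mem (b + j) = V s'.mem n j) ?_ ?_ ?_).mono le_rfl
    (fun s' h => ⟨h.1, h.2.2.2.1, h.2.2.2.2.1, h.2.2.2.2.2⟩)
  · refine ⟨?_, ?_, ?_, ?_, ?_, ?_⟩
    · simp [State.setReg, hr2, h01]
    · simp [State.setReg, hr2, hd1]
    · simp [State.setReg]
    · simpa [State.setReg, hm2] using hm
    · simp [State.setReg, hm2]
    · simp
  · simp [State.setReg, hd2, hN]
  · rintro i hi s3 hc ⟨h03, h13, h33, hmM, hmb, hmV⟩
    have hv := (hpv s3 (M ^ (Ks + 1)) (hM.trans hM1) (by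
      rintro (_ | j)
      · change s3.reg 3 ≤ _
        omega
      · change s3.reg 0 ≤ _
        omega) (fun k => (hmM k).trans hM1)).2
    rw [← pow_mul] at hv
    refine hv.seq (T' := 1 + (1 + (1 + (1 + 1)))) ?_
    rintro s4 ⟨hm4, hr4, hd4⟩
    replace hd4 : s4.reg 4 = V s3.mem n i := by
      rw [hd4, ← h03, ← h33]
      rfl
    refine Runs.seq (Runs.add (Q := fun s' => s' = _) rfl) ?_
    rintro _ rfl
    refine Runs.seq (Runs.store (Q := fun s' => s' = _) rfl) ?_
    rintro _ rfl
    refine Runs.seq (Runs.const (Q := fun s' => s' = _) rfl) ?_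
    rintro _ rfl
    refine Runs.seq (Runs.add (Q := fun s' => s' = _) rfl) ?_
    rintro _ rfl
    have hmem : ∀ k, Function.update s3.mem (b + i) (V s3.mem n i) k =
        if k = b + i then V s3.mem n i else s3.mem k := fun k => Function.update_apply _ _ _ _
    refine Runs.sub ⟨?_, ?_, ?_, ?_, ?_⟩
    · simp [State.setReg, State.setMem, hr4, hc]
      omega
    · simp [State.setReg, State.setMem, hr4, h03]
    · simp [State.setReg, State.setMem, hr4, h13]
    · simp [State.setReg, State.setMem, hr4, h33]
    simp only [State.setReg, State.setMem, ne_eq, Nat.reduceEqDiff,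
      not_false_eq_true, Function.update_of_ne, Function.update_self, hr4 1 (by omega),
      hr4 3 (by omega), h13, h33, hd4, hm4]
    have hlt : ∀ k < b, Function.update s3.mem (b + i) (V s3.mem n i) k = s.mem k := by
      intro k hk
      rw [hmem, if_neg (by omega), hmb k hk]
    refine ⟨fun k => ?_, hlt, fun j hj => ?_⟩
    · rw [hmem]
      split_ifs
      · exact hbd i hi _ hmb hmV
      · exact hmM k
    -- The cell just written is not among those on which the entries up to `i` depend, so their
    -- equations persist.
    · have h2 : V (Function.update s3.mem (b + i) (V s3.mem n i)) n j = V s3.mem n j := by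
        refine hloc j (by omega) _ _ hlt hmb fun j' hj' => ?_
        rw [hmem, if_neg (by omega)]
      rw [h2, hmem]
      split_ifs with h
      · rw [show j = i by omega]
      · exact hmV j (by omega)

/-! ### Greedy dominating sets -/

/-- One of the first `t` vertices of the list `D` is `w` or a neighbour of `w`. -/
def Covered (A : ℕ → ℕ → Prop) (D : ℕ → ℕ) (t w : ℕ) : Prop := ∃ j < t, D j = w ∨ A (D j) w

/-- The number of vertices that `v` would cover newly. -/
noncomputable def gain (n : ℕ) (A : ℕ → ℕ → Prop) (D : ℕ → ℕ) (t v : ℕ) : ℕ :=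
  ∑ w ∈ Finset.range n, ind ((v = w ∨ A v w) ∧ ¬ Covered A D t w)

/-- A vertex of maximal gain among those that satisfy `c`. -/
noncomputable def pick (n : ℕ) (A : ℕ → ℕ → Prop) (c : ℕ → Prop) (D : ℕ → ℕ) (t : ℕ) : ℕ :=
  first n fun v => c v ∧ ∀ u < n, c u → gain n A D t u ≤ gain n A D t v

/-- The number of rounds after which everything is covered. -/
noncomputable def rounds (n : ℕ) (A : ℕ → ℕ → Prop) (D : ℕ → ℕ) : ℕ :=
  ∑ t ∈ Finset.range n, ind (∃ w < n, ¬ Covered A D t w)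

theorem Covered.congr {A : ℕ → ℕ → Prop} {D D' : ℕ → ℕ} {t : ℕ} (h : ∀ j < t, D j = D' j) :
    Covered A D t = Covered A D' t := by
  funext w
  exact propext ⟨fun ⟨j, hj, h1⟩ => ⟨j, hj, by rwa [← h j hj]⟩,
    fun ⟨j, hj, h1⟩ => ⟨j, hj, by rwa [h j hj]⟩⟩

/-- A choice depends only on the choices before it; this is the locality that filling the table
requires. -/
theorem pick_congr {n : ℕ} {A : ℕ → ℕ → Prop} {c : ℕ → Prop} {D D' : ℕ → ℕ} {t : ℕ}
    (h : ∀ j < t, D j = D' j) : pick n A c D t = pick n A c D' t := by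
  simp only [pick, gain, Covered.congr h]

theorem rounds_congr {n : ℕ} {A : ℕ → ℕ → Prop} {D D' : ℕ → ℕ}
    (h : ∀ j < n, D j = D' j) : rounds n A D = rounds n A D' :=
  Finset.sum_congr rfl fun t ht => by
    rw [Covered.congr fun j hj => h j (hj.trans (Finset.mem_range.1 ht))]

section Greedy

variable {n : ℕ} {A : ℕ → ℕ → Prop} {c : ℕ → Prop} {D : ℕ → ℕ}

theorem Covered.mono {t t' w : ℕ} (h : t ≤ t') (hc : Covered A D t w) : Covered A D t' w := by
  obtain ⟨j, hj, h1⟩ := hc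
  exact ⟨j, by omega, h1⟩

open Classical in
/-- The vertices that are not covered after `t` rounds. -/
noncomputable def uncovered (n : ℕ) (A : ℕ → ℕ → Prop) (D : ℕ → ℕ) (t : ℕ) : Finset ℕ :=
  (Finset.range n).filter fun w => ¬ Covered A D t w

theorem mem_uncovered {t w : ℕ} : w ∈ uncovered n A D t ↔ w < n ∧ ¬ Covered A D t w := by
  simp [uncovered]

theorem card_uncovered_le (t : ℕ) : (uncovered n A D t).card ≤ n := by
  classical
  exact (Finset.card_filter_le _ _).trans (by simp)

theorem gain_eq_card (t v : ℕ) [DecidablePred fun w => v = w ∨ A v w] :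
    gain n A D t v = ((uncovered n A D t).filter fun w => v = w ∨ A v w).card := by
  classical
  rw [gain, sum_ind, uncovered, Finset.filter_filter]
  congr 1
  ext w
  simp [and_comm]

theorem card_uncovered_succ (t : ℕ) :
    (uncovered n A D (t + 1)).card + gain n A D t (D t) = (uncovered n A D t).card := by
  classical
  rw [gain_eq_card, ← Finset.card_filter_add_card_filter_not (s := uncovered n A D t)
    (p := fun w => D t = w ∨ A (D t) w), add_comm]
  congr 2
  ext w
  simp only [mem_uncovered, Finset.mem_filter, and_assoc]
  refine and_congr_right fun _ => ?_
  constructor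
  · exact fun h => ⟨fun h1 => h (h1.mono (by omega)), fun h1 => h ⟨t, by omega, h1⟩⟩
  · rintro ⟨h1, h2⟩ ⟨j, hj, h3⟩
    rcases Nat.lt_succ_iff_lt_or_eq.1 hj with hj | rfl
    · exact h1 ⟨j, hj, h3⟩
    · exact h2 h3

theorem pick_spec (hc : ∃ v < n, c v) (t : ℕ) : pick n A c D t < n ∧ c (pick n A c D t) ∧
    ∀ u < n, c u → gain n A D t u ≤ gain n A D t (pick n A c D t) := by
  classical
  obtain ⟨v, hv, hcv⟩ := hc
  obtain ⟨x, hx, hmax⟩ := Finset.exists_max_image ((Finset.range n).filter c) (gain n A D t)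
    ⟨v, by simp [hv, hcv]⟩
  simp only [Finset.mem_filter, Finset.mem_range, and_imp] at hx hmax
  exact first_spec (p := fun v => c v ∧ ∀ u < n, c u → gain n A D t u ≤ gain n A D t v)
    ⟨x, hx.1, hx.2, hmax⟩

/-- Coverage only grows, so the rounds that start with an uncovered vertex form an initial segment,
whose length is `rounds`. -/
theorem lt_rounds_iff {t : ℕ} (ht : t < n) :
    t < rounds n A D ↔ (uncovered n A D t).Nonempty := by
  classical
  have key : (Finset.range n).filter (fun t => ∃ w < n, ¬ Covered A D t w) =
      Finset.range (rounds n A D) := by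
    have hsub : ∀ s ∈ (Finset.range n).filter (fun t => ∃ w < n, ¬ Covered A D t w),
        Finset.range (s + 1) ⊆ (Finset.range n).filter (fun t => ∃ w < n, ¬ Covered A D t w) := by
      intro s hs r hr
      simp only [Finset.mem_filter, Finset.mem_range] at hs hr ⊢
      obtain ⟨h1, w, hw, h2⟩ := hs
      exact ⟨by omega, w, hw, fun h => h2 (h.mono (by omega))⟩
    rw [rounds, sum_ind]
    refine Finset.eq_of_subset_of_card_le (fun s hs => ?_) (by simp)
    have := Finset.card_le_card (hsub s hs)
    simpa using this
  rw [← Finset.mem_range, ← key]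
  simp only [Finset.mem_filter, Finset.mem_range, ht, true_and, Finset.Nonempty, mem_uncovered]

theorem rounds_le : rounds n A D ≤ n :=
  (Finset.sum_le_card_nsmul _ _ 1 fun i _ => ind_le_one _).trans (by simp)

variable (hdom : ∀ w < n, ∃ v < n, c v ∧ (v = w ∨ A v w)) (hD : ∀ t < n, D t = pick n A c D t)

include hdom hD

/-- Some candidate dominates a vertex that is still uncovered and so has positive gain; the chosen
one gains at least as much. -/
theorem pick_spec_of_lt_rounds {t : ℕ} (ht : t < rounds n A D) :
    D t < n ∧ c (D t) ∧ (∀ u < n, c u → gain n A D t u ≤ gain n A D t (D t)) ∧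
      1 ≤ gain n A D t (D t) := by
  classical
  have htn : t < n := ht.trans_le rounds_le
  obtain ⟨w, hw⟩ := (lt_rounds_iff htn).1 ht
  obtain ⟨v, hv, hcv, hvw⟩ := hdom w (mem_uncovered.1 hw).1
  obtain ⟨h1, h2, h3⟩ := pick_spec (A := A) (D := D) ⟨v, hv, hcv⟩ t
  rw [← hD t htn] at h1 h2 h3
  refine ⟨h1, h2, h3, le_trans ?_ (h3 v hv hcv)⟩
  rw [gain_eq_card]
  exact Finset.card_pos.2 ⟨w, Finset.mem_filter.2 ⟨hw, hvw⟩⟩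

theorem card_uncovered_add_le {t j : ℕ} (h : t + j ≤ rounds n A D) :
    (uncovered n A D (t + j)).card + j ≤ (uncovered n A D t).card := by
  induction j with
  | zero => simp
  | succ j ih =>
    have h1 := ih (by omega)
    have h2 := (pick_spec_of_lt_rounds hdom hD (t := t + j) (by omega)).2.2.2
    have h3 := card_uncovered_succ (n := n) (A := A) (D := D) (t + j)
    rw [← add_assoc t j 1]
    omega

/-- If `rounds` is less than `n`, this is its meaning. If it equals `n`, then `n` rounds with
positive gain have exhausted at most `n` vertices. -/
theorem covered_rounds {w : ℕ} (hw : w < n) : Covered A D (rounds n A D) w := by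
  classical
  by_contra hcon
  have hmem : w ∈ uncovered n A D (rounds n A D) := mem_uncovered.2 ⟨hw, hcon⟩
  rcases (rounds_le (n := n) (A := A) (D := D)).lt_or_eq with h | h
  · exact lt_irrefl _ ((lt_rounds_iff h).2 ⟨w, hmem⟩)
  · have h1 := card_uncovered_add_le hdom hD (t := 0) (j := rounds n A D) (by omega)
    have h2 : (uncovered n A D 0).card ≤ n := card_uncovered_le 0
    have h3 : 0 < (uncovered n A D (rounds n A D)).card := Finset.card_pos.2 ⟨w, hmem⟩
    rw [zero_add] at h1
    omega

/-- A repeated vertex would have gain zero, so the chosen candidates are distinct. -/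
theorem rounds_le_card [DecidablePred c] :
    rounds n A D ≤ ((Finset.range n).filter c).card := by
  classical
  rw [← Finset.card_range (rounds n A D)]
  refine Finset.card_le_card_of_injOn D (fun t ht => ?_) ?_
  · obtain ⟨h1, h2, -⟩ := pick_spec_of_lt_rounds hdom hD (Finset.mem_range.1 ht)
    simp [h1, h2]
  · have key : ∀ t t', t < t' → t' < rounds n A D → D t ≠ D t' := by
      intro t t' h h' he
      have h1 := (pick_spec_of_lt_rounds hdom hD h').2.2.2
      rw [gain_eq_card] at h1
      obtain ⟨w, hw⟩ := Finset.card_pos.1 h1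
      rw [Finset.mem_filter, mem_uncovered] at hw
      exact hw.1.2 ⟨t, h, by rw [he]; exact hw.2⟩
    intro t ht t' ht' he
    simp only [Finset.coe_range, Set.mem_Iio] at ht ht'
    rcases lt_trichotomy t t' with h | h | h
    · exact absurd he (key t t' h ht')
    · exact h
    · exact absurd he.symm (key t' t h ht)

variable {δ : ℕ}

/-- Count the pairs of a vertex and an uncovered vertex that it would cover: each uncovered vertex
lies in at least `δ` pairs, and each of the `n` vertices in at most as many as the maximal gain. -/
theorem mul_card_uncovered_succ_le (hc : ∀ v, c v)
    (hδ : ∀ w < n, ∃ S : Finset ℕ, S.card = δ ∧ ∀ v ∈ S, v < n ∧ A v w) {t : ℕ}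
    (ht : t < rounds n A D) :
    n * (uncovered n A D (t + 1)).card + δ * (uncovered n A D t).card ≤
      n * (uncovered n A D t).card := by
  classical
  obtain ⟨-, -, h1, -⟩ := pick_spec_of_lt_rounds hdom hD ht
  have h2 : ∑ v ∈ Finset.range n, gain n A D t v ≤ n * gain n A D t (D t) := by
    refine (Finset.sum_le_card_nsmul _ _ _ fun v hv => h1 v (Finset.mem_range.1 hv) (hc v)).trans ?_
    simp
  have h3 : δ * (uncovered n A D t).card ≤ ∑ v ∈ Finset.range n, gain n A D t v := by
    simp only [gain_eq_card, Finset.card_filter]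
    rw [Finset.sum_comm, mul_comm]
    refine Finset.card_nsmul_le_sum _ _ _ fun w hw => ?_
    obtain ⟨S, hS, hS'⟩ := hδ w (mem_uncovered.1 hw).1
    rw [← Finset.card_filter, ← hS]
    refine Finset.card_le_card fun v hv => ?_
    simp [hS' v hv]
  have h4 := card_uncovered_succ (n := n) (A := A) (D := D) t
  rw [← h4]
  rw [← h4] at h3
  nlinarith

theorem card_uncovered_le_exp (hc : ∀ v, c v)
    (hδ : ∀ w < n, ∃ S : Finset ℕ, S.card = δ ∧ ∀ v ∈ S, v < n ∧ A v w) {t : ℕ}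
    (ht : t ≤ rounds n A D) :
    ((uncovered n A D t).card : ℝ) ≤ n * Real.exp (-(δ / n) * t) := by
  induction t with
  | zero =>
    have h2 : (uncovered n A D 0).card ≤ n := card_uncovered_le 0
    simpa using h2
  | succ t ih =>
    have hn : (0 : ℝ) < n := by
      have := rounds_le (n := n) (A := A) (D := D)
      exact_mod_cast (by omega : 0 < n)
    have h1 := mul_card_uncovered_succ_le hdom hD hc hδ (t := t) (by omega)
    have h2 := ih (by omega)
    have h3 : (n : ℝ) * (uncovered n A D (t + 1)).card + δ * (uncovered n A D t).card ≤
      n * (uncovered n A D t).card := by exact_mod_cast h1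
    have h4 : ((uncovered n A D (t + 1)).card : ℝ) ≤
        (1 - δ / n) * (uncovered n A D t).card := by
      rw [← mul_le_mul_iff_right₀ hn]
      have : (n : ℝ) * ((1 - δ / n) * (uncovered n A D t).card) =
          n * (uncovered n A D t).card - δ * (uncovered n A D t).card := by
        field_simp
      linarith
    have h5 : 1 - (δ / n : ℝ) ≤ Real.exp (-(δ / n)) := by
      have := Real.add_one_le_exp (-(δ / n : ℝ))
      linarith
    calc ((uncovered n A D (t + 1)).card : ℝ) ≤ (1 - δ / n) * (uncovered n A D t).card := h4
      _ ≤ Real.exp (-(δ / n)) * (uncovered n A D t).card := by gcongr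
      _ ≤ Real.exp (-(δ / n)) * (n * Real.exp (-(δ / n) * t)) := by gcongr
      _ = n * Real.exp (-(δ / n) * (t + 1 : ℕ)) := by
        rw [mul_left_comm, ← Real.exp_add]
        push_cast
        ring_nf

/-- With `L = n / δ * logb 2 δ ≥ 1`, at most `L + 1` rounds leave at most `n / δ ≤ L` vertices, and
every further round covers at least one of them. The total is at most `3 * L`. -/
theorem rounds_le_log (hc : ∀ v, c v)
    (hδ : ∀ w < n, ∃ S : Finset ℕ, S.card = δ ∧ ∀ v ∈ S, v < n ∧ A v w) (h2 : 2 ≤ δ)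
    (hδn : δ ≤ n) : (rounds n A D : ℝ) ≤ 3 * (n / δ * Real.logb 2 δ) := by
  have hδ2 : (2 : ℝ) ≤ δ := by exact_mod_cast h2
  have hδn' : (δ : ℝ) ≤ n := by exact_mod_cast hδn
  have hm : (1 : ℝ) ≤ n / δ := by rwa [le_div_iff₀ (by linarith), one_mul]
  have hlog1 : 1 ≤ Real.logb 2 δ := by
    rw [Real.le_logb_iff_rpow_le (by norm_num) (by linarith)]
    simpa using hδ2
  have hln : Real.log δ ≤ Real.logb 2 δ := by
    rw [Real.logb, le_div_iff₀ (Real.log_pos (by norm_num))]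
    have h3 : Real.log 2 ≤ 1 := (Real.log_two_lt_d9.le).trans (by norm_num)
    have h4 : 0 ≤ Real.log δ := Real.log_nonneg (by linarith)
    nlinarith
  set L := n / δ * Real.logb 2 δ with hL
  have e1 : 1 ≤ L := by nlinarith
  have e2 : (n / δ : ℝ) ≤ L := by nlinarith
  have e3 : n / δ * Real.log δ ≤ L := by
    rw [hL]
    gcongr
  set t := ⌈n / δ * Real.log δ⌉₊ with ht
  have ht1 : (t : ℝ) ≤ L + 1 := by
    have := Nat.ceil_lt_add_one (a := n / δ * Real.log δ)
      (mul_nonneg (by linarith) (Real.log_nonneg (by linarith)))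
    linarith
  rcases le_total (rounds n A D) t with h | h
  · have : (rounds n A D : ℝ) ≤ t := by exact_mod_cast h
    linarith
  · have h3 := card_uncovered_le_exp hdom hD hc hδ h
    have h4 := card_uncovered_add_le hdom hD (t := t) (j := rounds n A D - t) (by omega)
    have h5 : rounds n A D ≤ t + (uncovered n A D t).card := by omega
    have h6 : (rounds n A D : ℝ) ≤ t + (uncovered n A D t).card := by exact_mod_cast h5
    have h7 : (n : ℝ) * Real.exp (-(δ / n) * t) ≤ n / δ := by
      rw [div_eq_mul_inv (n : ℝ)]
      refine mul_le_mul_of_nonneg_left ?_ (by linarith)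
      rw [← Real.exp_log (show (0 : ℝ) < δ by linarith), ← Real.exp_neg, Real.exp_log (by linarith)]
      refine Real.exp_le_exp.2 ?_
      have h8 : n / δ * Real.log δ ≤ t := Nat.le_ceil _
      have h9 : (0 : ℝ) ≤ δ / n := by positivity
      have h10 := mul_le_mul_of_nonneg_left h8 h9
      have h11 : (δ / n : ℝ) * (n / δ * Real.log δ) = Real.log δ := by
        have : (n : ℝ) ≠ 0 := by linarith
        field_simp
      linarith
    linarith

end Greedy

/-! ### List colouring with lists of size two -/

/-- The literal `x = 3 v + c` (vertex `v` has colour `c`) is excluded by a vertex `D j = v` that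
has colour `dig j ≠ c`. -/
def Excluded (k : ℕ) (D dig : ℕ → ℕ) (x : ℕ) : Prop := ∃ j < k, D j = x / 3 ∧ dig j ≠ x % 3

/-- The pairs of literals that are forbidden directly. -/
def Clash (A : ℕ → ℕ → Prop) (k : ℕ) (D dig : ℕ → ℕ) (x y : ℕ) : Prop :=
  (x / 3 = y / 3 ∧ x % 3 ≠ y % 3) ∨ (A (x / 3) (y / 3) ∧ x % 3 = y % 3) ∨
    Excluded k D dig x ∨ Excluded k D dig y

/-- One step of the path consistency closure: a pair of literals is forbidden if all three
colours of some vertex are in conflict with the pair. -/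
def Derive (n : ℕ) (R : ℕ → ℕ → Prop) (x y : ℕ) : Prop :=
  R x y ∨ ∃ u < n, ∀ e < 3, R x (3 * u + e) ∨ R (3 * u + e) y

theorem Derive.congr {n : ℕ} {R R' : ℕ → ℕ → Prop} (h : ∀ x < 3 * n, ∀ y < 3 * n, R x y ↔ R' x y)
    {x y : ℕ} (hx : x < 3 * n) (hy : y < 3 * n) : Derive n R x y ↔ Derive n R' x y := by
  refine or_congr (h x hx y hy) (exists_congr fun u => and_congr_right fun hu =>
    forall_congr' fun e => imp_congr_right fun he => ?_)
  rw [h x hx _ (by omega), h _ (by omega) y hy]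

theorem iterate_derive_mono {n : ℕ} {R : ℕ → ℕ → Prop} {x y t t' : ℕ} (htt : t ≤ t')
    (h : (Derive n)^[t] R x y) : (Derive n)^[t'] R x y := by
  induction t', htt using Nat.le_induction with
  | base => exact h
  | succ t' _ ih =>
    rw [Function.iterate_succ_apply']
    exact .inl ih

theorem iterate_derive_symm {n : ℕ} {R : ℕ → ℕ → Prop} (hR : ∀ x y, R x y → R y x) (t : ℕ) :
    ∀ x y, (Derive n)^[t] R x y → (Derive n)^[t] R y x := by
  induction t with
  | zero => exact hR
  | succ t ih =>
    intro x y h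
    rw [Function.iterate_succ_apply'] at h ⊢
    rcases h with h | ⟨u, hu, h⟩
    · exact .inl (ih _ _ h)
    · exact .inr ⟨u, hu, fun e he => (h e he).symm.imp (ih _ _) (ih _ _)⟩

/-- After as many steps as there are pairs of literals, the closure is complete. -/
theorem iterate_derive_closed (n : ℕ) (R : ℕ → ℕ → Prop) {x y : ℕ} (hx : x < 3 * n)
    (hy : y < 3 * n) (h : Derive n ((Derive n)^[3 * n * (3 * n)] R) x y) :
    (Derive n)^[3 * n * (3 * n)] R x y := by
  classical
  set T := 3 * n * (3 * n) with hT
  let S : ℕ → Finset (ℕ × ℕ) := fun t =>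
    (Finset.range (3 * n) ×ˢ Finset.range (3 * n)).filter fun q => (Derive n)^[t] R q.1 q.2
  have hmono : Monotone S := fun t t' htt q hq => by
    simp only [S, Finset.mem_filter] at hq ⊢
    exact ⟨hq.1, iterate_derive_mono htt hq.2⟩
  -- A stage determines the next one, so an increasing chain of subsets of a set with `T` elements
  -- is constant from stage `T` on.
  have hstep : ∀ t t', S t = S t' → S (t + 1) = S (t' + 1) := by
    intro t t' he
    refine Finset.filter_congr fun q hq => ?_
    rw [Finset.mem_product, Finset.mem_range, Finset.mem_range] at hq
    rw [Function.iterate_succ_apply', Function.iterate_succ_apply']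
    refine Derive.congr (fun x hx y hy => ?_) hq.1 hq.2
    have := congrArg (fun s => (x, y) ∈ s) he
    simpa [S, hx, hy] using this
  have hstab := Nat.stabilises_of_monotone (f := fun t => (S t).card) (b := T) (n := T + 1)
    (fun t t' htt => Finset.card_le_card (hmono htt))
    (fun t => (Finset.card_filter_le _ _).trans (by simp [hT]))
    (fun t ht => by
      have he := Finset.eq_of_subset_of_card_le (hmono (Nat.le_succ t)) ht.symm.le
      exact congrArg Finset.card (hstep _ _ he))
    (Nat.le_succ _)
  have he := Finset.eq_of_subset_of_card_le (hmono (Nat.le_succ T)) hstab.le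
  have hmem : (x, y) ∈ S (T + 1) := by
    simp only [S, Finset.mem_filter, Finset.mem_product, Finset.mem_range]
    rw [Function.iterate_succ_apply']
    exact ⟨⟨hx, hy⟩, h⟩
  rw [← he] at hmem
  simp only [S, Finset.mem_filter] at hmem
  exact hmem.2

/-- A closed symmetric relation under which every vertex has lost a colour does not obstruct
colouring, by the Helly property of subsets of a set of two colours. -/
theorem exists_coloring_of_closed {n : ℕ} {R : ℕ → ℕ → Prop} (hsymm : ∀ x y, R x y → R y x)
    (hclosed : ∀ x < 3 * n, ∀ y < 3 * n, Derive n R x y → R x y)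
    (hdiff : ∀ x y, x / 3 = y / 3 → x % 3 ≠ y % 3 → R x y)
    (hlost : ∀ u < n, ∃ e < 3, R (3 * u + e) (3 * u + e))
    {c : ℕ} (hc : c < 3) (h0 : ¬ R c c) :
    ∃ f : ℕ → ℕ, (∀ u, f u < 3) ∧ ∀ u < n, ∀ v < n, ¬ R (3 * u + f u) (3 * v + f v) := by
  -- A literal in conflict with itself is in conflict with every literal: its vertex has no colour
  -- left that is compatible with both.
  have hunary : ∀ u < n, ∀ e < 3, R (3 * u + e) (3 * u + e) → ∀ y < 3 * n, R y (3 * u + e) := by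
    intro u hu e he h y hy
    refine hclosed _ hy _ (by omega) (.inr ⟨u, hu, fun e' he' => .inr ?_⟩)
    by_cases hee : e' = e
    · rwa [hee]
    · exact hdiff _ _ (by omega) (by omega)
  -- The vertices are coloured one by one, without backtracking, starting with colour `c` at vertex
  -- 0.
  suffices H : ∀ k ≤ n, ∃ f : ℕ → ℕ, (∀ u, f u < 3) ∧ (0 < k → f 0 = c) ∧
      ∀ u < k, ∀ v < k, ¬ R (3 * u + f u) (3 * v + f v) by
    obtain ⟨f, h1, -, h2⟩ := H n le_rfl
    exact ⟨f, h1, h2⟩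
  intro k
  induction k with
  | zero => exact fun _ => ⟨fun _ => 0, by simp, by simp, by simp⟩
  | succ k ih =>
    intro hk
    obtain ⟨f, hf3, hf0, hf⟩ := ih (by omega)
    rcases Nat.eq_zero_or_pos k with rfl | hkpos
    · refine ⟨fun _ => c, fun _ => hc, fun _ => rfl, fun u hu v hv => ?_⟩
      obtain rfl : u = 0 := by omega
      obtain rfl : v = 0 := by omega
      simpa using h0
    suffices H : ∃ e < 3, ¬ R (3 * k + e) (3 * k + e) ∧ ∀ v < k, ¬ R (3 * v + f v) (3 * k + e) by
      obtain ⟨e, he, h1, h2⟩ := H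
      refine ⟨Function.update f k e, fun u => ?_, fun _ => ?_, fun u hu v hv => ?_⟩
      · rw [Function.update_apply]
        split_ifs
        exacts [he, hf3 u]
      · rw [Function.update_of_ne (by omega), hf0 hkpos]
      · rw [Function.update_apply, Function.update_apply]
        split_ifs with hu' hv' hv'
        · subst hu' hv'
          exact h1
        · subst hu'
          exact fun h => h2 v (by omega) (hsymm _ _ h)
        · subst hv'
          exact h2 u (by omega)
        · exact hf u (by omega) v (by omega)
    by_contra hcon
    push Not at hcon
    have hbad : ∀ e < 3, ∃ v < k, R (3 * v + f v) (3 * k + e) := by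
      intro e he
      by_cases h : R (3 * k + e) (3 * k + e)
      · have := hf3 0
        exact ⟨0, hkpos, hunary k (by omega) e he h _ (by omega)⟩
      · exact hcon e he h
    -- One colour of `k` is lost anyway, and two earlier vertices block the other two. Then all
    -- colours of `k` conflict with this pair, so closure forbids the pair, although both vertices
    -- are already coloured compatibly.
    obtain ⟨e, he, hR⟩ := hlost k (by omega)
    obtain ⟨v₁, hv₁, h₁⟩ := hbad ((e + 1) % 3) (by omega)
    obtain ⟨v₂, hv₂, h₂⟩ := hbad ((e + 2) % 3) (by omega)
    have hf1 := hf3 v₁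
    have hf2 := hf3 v₂
    refine hf v₁ hv₁ v₂ hv₂ (hclosed _ (by omega) _ (by omega) (.inr ⟨k, by omega, fun e' he' => ?_⟩))
    have : e' = e ∨ e' = (e + 1) % 3 ∨ e' = (e + 2) % 3 := by omega
    rcases this with rfl | rfl | rfl
    · exact .inl (hunary k (by omega) _ he' hR _ (by omega))
    · exact .inl h₁
    · exact .inr (hsymm _ _ h₂)

/-- If the vertices `D 0, …, D (k - 1)` dominate a graph on `0, …, n - 1`, then the closure decides
whether their colouring extends to the graph. -/
theorem exists_coloring_iff {n k : ℕ} (hn : 0 < n) {A : ℕ → ℕ → Prop} {D dig : ℕ → ℕ}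
    (hsymm : ∀ u v, A u v → A v u) (hD : ∀ j < k, D j < n) (hdig : ∀ j, dig j < 3)
    (hcov : ∀ w < n, Covered A D k w) :
    (∃ c < 3, ¬ (Derive n)^[3 * n * (3 * n)] (Clash A k D dig) c c) ↔
      ∃ f : ℕ → ℕ, (∀ u, f u < 3) ∧ (∀ u < n, ∀ v < n, A u v → f u ≠ f v) ∧
        ∀ j < k, f (D j) = dig j := by
  set T := 3 * n * (3 * n)
  have hinit : ∀ x y, Clash A k D dig x y → (Derive n)^[T] (Clash A k D dig) x y :=
    fun x y h => iterate_derive_mono (t := 0) (Nat.zero_le _) h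
  constructor
  · rintro ⟨c, hc, h0⟩
    have hclosed : ∀ x < 3 * n, ∀ y < 3 * n, Derive n ((Derive n)^[T] (Clash A k D dig)) x y →
        (Derive n)^[T] (Clash A k D dig) x y :=
      fun x hx y hy => iterate_derive_closed n (Clash A k D dig) hx hy
    obtain ⟨f, hf3, hf⟩ := exists_coloring_of_closed (R := (Derive n)^[T] (Clash A k D dig))
      (iterate_derive_symm (by
        rintro x y (h | h | h)
        · exact .inl ⟨h.1.symm, h.2.symm⟩
        · exact .inr (.inl ⟨hsymm _ _ h.1, h.2.symm⟩)
        · exact .inr (.inr h.symm)) T)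
      hclosed
      (fun x y h1 h2 => hinit _ _ (.inl ⟨h1, h2⟩)) (by
        intro u hu
        obtain ⟨j, hj, hju⟩ := hcov u hu
        have h3 := hdig j
        rcases hju with rfl | hju
        · refine ⟨(dig j + 1) % 3, by omega, hinit _ _ (.inr (.inr (.inl ⟨j, hj, by omega, ?_⟩)))⟩
          omega
        -- A neighbour of `D j` loses the colour `dig j`: of the colours of `D j`, this one clashes
        -- along the edge and the other two are excluded.
        · refine ⟨dig j, h3, hclosed _ (by omega) _ (by omega)
            (.inr ⟨D j, hD j hj, fun e he => ?_⟩)⟩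
          by_cases hed : e = dig j
          · refine .inl (hinit _ _ (.inr (.inl ⟨?_, by omega⟩)))
            rw [show (3 * u + dig j) / 3 = u by omega, show (3 * D j + e) / 3 = D j by omega]
            exact hsymm _ _ hju
          · refine .inr (hinit _ _ (.inr (.inr (.inl ⟨j, hj, by omega, ?_⟩))))
            omega) hc h0
    refine ⟨f, hf3, fun u hu v hv huv he => hf u hu v hv (hinit _ _ (.inr (.inl ?_))),
      fun j hj => ?_⟩
    · have h1 := hf3 u
      have h2 := hf3 v
      rw [show (3 * u + f u) / 3 = u by omega, show (3 * v + f v) / 3 = v by omega]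
      exact ⟨huv, by omega⟩
    · by_contra hne
      have h1 := hf3 (D j)
      refine hf _ (hD j hj) _ (hD j hj) (hinit _ _ (.inr (.inr (.inl ⟨j, hj, by omega, ?_⟩))))
      omega
  · rintro ⟨f, hf3, hfA, hfD⟩
    -- Soundness: no pair of literals that are true under `f` is ever forbidden, since the colour `f
    -- w` of an intermediate vertex `w` conflicts with neither.
    have key : ∀ t, ∀ u < n, ∀ v < n,
        ¬ (Derive n)^[t] (Clash A k D dig) (3 * u + f u) (3 * v + f v) := by
      intro t
      induction t with
      | zero =>
        have hex : ∀ u, ¬ Excluded k D dig (3 * u + f u) := by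
          rintro u ⟨j, hj, h1, h2⟩
          have h3 := hf3 u
          rw [show (3 * u + f u) / 3 = u by omega] at h1
          have h4 := hfD j hj
          rw [h1] at h4
          omega
        intro u hu v hv h
        have h1 := hf3 u
        have h2 := hf3 v
        rcases h with h | h | h | h
        · obtain rfl : u = v := by omega
          exact h.2 rfl
        · rw [show (3 * u + f u) / 3 = u by omega, show (3 * v + f v) / 3 = v by omega] at h
          exact hfA u hu v hv h.1 (by omega)
        · exact hex u h
        · exact hex v h
      | succ t ih =>
        intro u hu v hv h
        rw [Function.iterate_succ_apply'] at h
        rcases h with h | ⟨w, hw, h⟩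
        · exact ih u hu v hv h
        · rcases h (f w) (hf3 w) with h | h
          · exact ih u hu w hw h
          · exact ih w hw v hv h
    -- A literal `c < 3` is colour `c` of vertex 0.
    exact ⟨f 0, hf3 0, by simpa using key T 0 hn 0 hn⟩

/-- Every sequence of `k` colours is the sequence of ternary digits of a number below `3 ^ k`. -/
theorem exists_digits (g : ℕ → ℕ) (hg : ∀ j, g j < 3) (k : ℕ) :
    ∃ X < 3 ^ k, ∀ j < k, X / 3 ^ j % 3 = g j := by
  induction k generalizing g with
  | zero => exact ⟨0, by simp, by simp⟩
  | succ k ih =>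
    obtain ⟨X, hX, h⟩ := ih (fun j => g (j + 1)) fun j => hg _
    have h0 := hg 0
    refine ⟨g 0 + 3 * X, by rw [pow_succ]; omega, fun j hj => ?_⟩
    rcases j with _ | j
    · simp
      omega
    · rw [pow_succ', ← Nat.div_div_eq_div_mul, show (g 0 + 3 * X) / 3 = X by omega]
      exact h j (by omega)

/-! ### The tables of the algorithm -/

/-- Adjacency, read off from the first `n²` memory cells. -/
def AdjMem (m : ℕ → ℕ) (n u v : ℕ) : Prop := u < n ∧ v < n ∧ m (u * n + v) ≠ 0

/-- The list of vertices chosen greedily among the neighbours of `s`, or among all vertices if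
`s = n`. -/
def domTable (m : ℕ → ℕ) (n s t : ℕ) : ℕ := m (n * n + (s * n + t))

/-- The vertices that are allowed in the `s`-th list. -/
def Candidate (m : ℕ → ℕ) (n s v : ℕ) : Prop := s = n ∨ AdjMem m n s v

/-- The `i`-th entry of the table of greedy lists. -/
noncomputable def domEntry (m : ℕ → ℕ) (n i : ℕ) : ℕ :=
  pick n (AdjMem m n) (Candidate m n (i / n)) (domTable m n (i / n)) (i % n)

/-- The length of the `s`-th dominating list. -/
noncomputable def listSize (m : ℕ → ℕ) (n s : ℕ) : ℕ := rounds n (AdjMem m n) (domTable m n s)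

/-- The index of a shortest dominating list. -/
noncomputable def source (m : ℕ → ℕ) (n : ℕ) : ℕ :=
  first (n + 1) fun s => ∀ s' < n + 1, listSize m n s ≤ listSize m n s'

/-- The length of a shortest dominating list. -/
noncomputable def domSize (m : ℕ → ℕ) (n : ℕ) : ℕ := listSize m n (source m n)

/-- The first cell of the table of powers of three. -/
def powBase (n : ℕ) : ℕ := n * n + (n + 1) * n

/-- The `i`-th entry of the table of powers of three. -/
def powEntry (m : ℕ → ℕ) (n i : ℕ) : ℕ := if i = 0 then 1 else 3 * m (powBase n + (i - 1))

/-- The first cell of the table of forbidden pairs. -/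
def relBase (n : ℕ) : ℕ := powBase n + (n + 1)

/-- The `j`-th ternary digit of `X`. -/
def digit (m : ℕ → ℕ) (n X j : ℕ) : ℕ := X / m (powBase n + j) % 3

/-- The number of colourings of the dominating list. -/
noncomputable def colorings (m : ℕ → ℕ) (n : ℕ) : ℕ := m (powBase n + domSize m n)

/-- The number of steps of the closure. -/
def steps (n : ℕ) : ℕ := 3 * n * (3 * n)

/-- The position of the pair `(x, y)` after `t` steps of the closure for the colouring `X`. -/
def relIndex (n X t x y : ℕ) : ℕ := ((X * (steps n + 1) + t) * (3 * n) + x) * (3 * n) + y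

/-- The pair `(x, y)` is forbidden after `t` steps of the closure for the colouring `X`. -/
def RelMem (m : ℕ → ℕ) (n X t x y : ℕ) : Prop := m (relBase n + relIndex n X t x y) ≠ 0

/-- The next entry of the table of forbidden pairs. -/
def NextRel (m : ℕ → ℕ) (n X t x y : ℕ) : Prop :=
  (t = 0 ∧ Clash (AdjMem m n) (domSize m n) (domTable m n (source m n)) (digit m n X) x y) ∨
    (t ≠ 0 ∧ Derive n (RelMem m n X (t - 1)) x y)

/-- The `i`-th entry of the table of forbidden pairs. -/
noncomputable def relEntry (m : ℕ → ℕ) (n i : ℕ) : ℕ :=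
  ind (NextRel m n (i / (3 * n) / (3 * n) / (steps n + 1)) (i / (3 * n) / (3 * n) % (steps n + 1))
    (i / (3 * n) % (3 * n)) (i % (3 * n)))

/-- The answer: whether some colouring of the dominating list extends. -/
noncomputable def answer (m : ℕ → ℕ) (n : ℕ) : ℕ :=
  ind (∃ X < colorings m n, ∃ c < 3, ¬ RelMem m n X (steps n) c c)

theorem compP_adjMem : CompP fun m a => AdjMem m (a 0) (a 1) (a 2) :=
  (CompP.lt (.var 1) (.var 0)).and ((CompP.lt (.var 2) (.var 0)).and
    (.ne_zero (.load (((Comp.var 1).mul (.var 0)).add (.var 2)))))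

theorem comp_domTable : Comp fun m a => domTable m (a 0) (a 1) (a 2) :=
  .load (((Comp.var 0).mul (.var 0)).add (((Comp.var 1).mul (.var 0)).add (.var 2)))

theorem compP_candidate : CompP fun m a => Candidate m (a 0) (a 1) (a 2) :=
  (CompP.eq (.var 1) (.var 0)).or compP_adjMem

theorem compP_covered : CompP fun m a =>
    Covered (AdjMem m (a 0)) (domTable m (a 0) (a 1)) (a 2) (a 3) := by
  refine CompP.ex (P := fun m j a => domTable m (a 0) (a 1) j = a 3 ∨
    AdjMem m (a 0) (domTable m (a 0) (a 1) j) (a 3)) (.var 2) ?_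
  have hD : Comp fun m a => domTable m (a 1) (a 2) (a 0) :=
    comp_domTable.comp₃ (.var 1) (.var 2) (.var 0)
  exact (CompP.eq hD (.var 4)).or (compP_adjMem.comp₃ (.var 1) hD (.var 4))

theorem comp_gain : Comp fun m a =>
    gain (a 0) (AdjMem m (a 0)) (domTable m (a 0) (a 1)) (a 2) (a 3) := by
  refine Comp.sum (F := fun m w a => ind ((a 3 = w ∨ AdjMem m (a 0) (a 3) w) ∧
    ¬ Covered (AdjMem m (a 0)) (domTable m (a 0) (a 1)) (a 2) w)) (.var 0) ?_
  have h1 : CompP fun m a => Covered (AdjMem m (a 1)) (domTable m (a 1) (a 2)) (a 3) (a 0) :=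
    compP_covered.comp₄ (p := fun m n s t w => Covered (AdjMem m n) (domTable m n s) t w)
      (.var 1) (.var 2) (.var 3) (.var 0)
  exact ((CompP.eq (.var 4) (.var 0)).or (compP_adjMem.comp₃ (.var 1) (.var 4) (.var 0))).and h1.not

theorem comp_pick : Comp fun m a =>
    pick (a 0) (AdjMem m (a 0)) (Candidate m (a 0) (a 1)) (domTable m (a 0) (a 1)) (a 2) := by
  refine Comp.first (P := fun m v a => Candidate m (a 0) (a 1) v ∧ ∀ u < a 0, Candidate m (a 0) (a 1) u →
    gain (a 0) (AdjMem m (a 0)) (domTable m (a 0) (a 1)) (a 2) u ≤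
      gain (a 0) (AdjMem m (a 0)) (domTable m (a 0) (a 1)) (a 2) v) (.var 0) ?_
  refine (compP_candidate.comp₃ (.var 1) (.var 2) (.var 0)).and ?_
  refine CompP.all (P := fun m u a => Candidate m (a 1) (a 2) u →
    gain (a 1) (AdjMem m (a 1)) (domTable m (a 1) (a 2)) (a 3) u ≤
      gain (a 1) (AdjMem m (a 1)) (domTable m (a 1) (a 2)) (a 3) (a 0)) (.var 1) ?_
  refine (compP_candidate.comp₃ (.var 2) (.var 3) (.var 0)).imp (CompP.le ?_ ?_)
  · exact comp_gain.comp₄ (f := fun m n s t v => gain n (AdjMem m n) (domTable m n s) t v)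
      (.var 2) (.var 3) (.var 4) (.var 0)
  · exact comp_gain.comp₄ (f := fun m n s t v => gain n (AdjMem m n) (domTable m n s) t v)
      (.var 2) (.var 3) (.var 4) (.var 1)

theorem comp_domEntry : Comp fun m a => domEntry m (a 1) (a 0) :=
  comp_pick.comp₃ (f := fun m n s t => pick n (AdjMem m n) (Candidate m n s) (domTable m n s) t)
    (.var 1) ((Comp.var 0).div (.var 1)) ((Comp.var 0).mod (.var 1))

theorem comp_listSize : Comp fun m a => listSize m (a 0) (a 1) := by
  refine Comp.sum (F := fun m t a => ind (∃ w < a 0,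
    ¬ Covered (AdjMem m (a 0)) (domTable m (a 0) (a 1)) t w)) (.var 0) ?_
  refine CompP.ex (P := fun m w a =>
    ¬ Covered (AdjMem m (a 1)) (domTable m (a 1) (a 2)) (a 0) w) (.var 1) (CompP.not ?_)
  exact compP_covered.comp₄ (p := fun m n s t w => Covered (AdjMem m n) (domTable m n s) t w)
      (.var 2) (.var 3) (.var 1) (.var 0)

theorem comp_source : Comp fun m a => source m (a 0) := by
  refine Comp.first (P := fun m s a => ∀ s' < a 0 + 1, listSize m (a 0) s ≤ listSize m (a 0) s')
    ((Comp.var 0).add (.const 1)) ?_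
  refine CompP.all (P := fun m s' a => listSize m (a 1) (a 0) ≤ listSize m (a 1) s')
    ((Comp.var 1).add (.const 1)) (CompP.le ?_ ?_)
  · exact comp_listSize.comp₂ (.var 2) (.var 1)
  · exact comp_listSize.comp₂ (.var 2) (.var 0)

theorem comp_domSize : Comp fun m a => domSize m (a 0) :=
  comp_listSize.comp₂ (.var 0) comp_source

theorem comp_powBase : Comp fun _ a => powBase (a 0) :=
  ((Comp.var 0).mul (.var 0)).add (((Comp.var 0).add (.const 1)).mul (.var 0))

theorem comp_powEntry : Comp fun m a => powEntry m (a 1) (a 0) := by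
  refine CompP.ite (CompP.eq (.var 0) (.const 0)) (.const 1) ((Comp.const 3).mul (.load ?_))
  exact (comp_powBase.comp₁ (f := fun _ n => powBase n) (.var 1)).add ((Comp.var 0).sub (.const 1))

theorem comp_relBase : Comp fun _ a => relBase (a 0) :=
  comp_powBase.add ((Comp.var 0).add (.const 1))

theorem comp_digit : Comp fun m a => digit m (a 0) (a 1) (a 2) :=
  ((Comp.var 1).div (.load (comp_powBase.add (.var 2)))).mod (.const 3)

theorem comp_colorings : Comp fun m a => colorings m (a 0) :=
  .load (comp_powBase.add comp_domSize)

theorem comp_three_mul : Comp fun _ a => 3 * a 0 := (Comp.const 3).mul (.var 0)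

theorem comp_steps : Comp fun _ a => steps (a 0) := comp_three_mul.mul comp_three_mul

theorem compP_relMem {N X T F G : (ℕ → ℕ) → (ℕ → ℕ) → ℕ} (hN : Comp N) (hX : Comp X) (hT : Comp T)
    (hF : Comp F) (hG : Comp G) : CompP fun m a => RelMem m (N m a) (X m a) (T m a) (F m a) (G m a) := by
  have h3 := (Comp.const 3).mul hN
  exact .ne_zero (.load ((comp_relBase.comp₁ (f := fun _ n => relBase n) hN).add
    ((((((hX.mul ((comp_steps.comp₁ (f := fun _ n => steps n) hN).add (.const 1))).add hT).mul
      h3).add hF).mul h3).add hG)))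

theorem compP_excluded : CompP fun m a =>
    Excluded (domSize m (a 0)) (domTable m (a 0) (source m (a 0))) (digit m (a 0) (a 1)) (a 2) := by
  refine CompP.ex (P := fun m j a => domTable m (a 0) (source m (a 0)) j = a 2 / 3 ∧
    digit m (a 0) (a 1) j ≠ a 2 % 3) comp_domSize ?_
  refine (CompP.eq ?_ ((Comp.var 3).div (.const 3))).and
    (CompP.ne ?_ ((Comp.var 3).mod (.const 3)))
  · exact comp_domTable.comp₃ (.var 1) (comp_source.comp₁ (.var 1)) (.var 0)
  · exact comp_digit.comp₃ (.var 1) (.var 2) (.var 0)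

theorem compP_clash : CompP fun m a =>
    Clash (AdjMem m (a 0)) (domSize m (a 0)) (domTable m (a 0) (source m (a 0)))
      (digit m (a 0) (a 1)) (a 2) (a 3) := by
  have hd : ∀ k, Comp fun _ a => a k / 3 := fun k => (Comp.var k).div (.const 3)
  have hm : ∀ k, Comp fun _ a => a k % 3 := fun k => (Comp.var k).mod (.const 3)
  refine ((CompP.eq (hd 2) (hd 3)).and (CompP.ne (hm 2) (hm 3))).or
    (((compP_adjMem.comp₃ (.var 0) (hd 2) (hd 3)).and (CompP.eq (hm 2) (hm 3))).or
      (compP_excluded.or ?_))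
  exact compP_excluded.comp₃ (p := fun m n X x =>
    Excluded (domSize m n) (domTable m n (source m n)) (digit m n X) x) (.var 0) (.var 1) (.var 3)

theorem compP_derive : CompP fun m a =>
    Derive (a 0) (RelMem m (a 0) (a 1) (a 2 - 1)) (a 3) (a 4) := by
  refine (compP_relMem (.var 0) (.var 1) ((Comp.var 2).sub (.const 1)) (.var 3) (.var 4)).or ?_
  refine CompP.ex (P := fun m u a => ∀ e < 3, RelMem m (a 0) (a 1) (a 2 - 1) (a 3) (3 * u + e) ∨
    RelMem m (a 0) (a 1) (a 2 - 1) (3 * u + e) (a 4)) (.var 0) ?_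
  refine CompP.all (B := fun _ _ => 3) (P := fun m e a =>
    RelMem m (a 1) (a 2) (a 3 - 1) (a 4) (3 * a 0 + e) ∨
    RelMem m (a 1) (a 2) (a 3 - 1) (3 * a 0 + e) (a 5)) (.const 3) ?_
  have hl : Comp fun _ a => 3 * a 1 + a 0 := ((Comp.const 3).mul (.var 1)).add (.var 0)
  have ht : Comp fun _ a => a 4 - 1 := (Comp.var 4).sub (.const 1)
  exact (compP_relMem (.var 2) (.var 3) ht (.var 5) hl).or
    (compP_relMem (.var 2) (.var 3) ht hl (.var 6))

theorem compP_nextRel : CompP fun m a => NextRel m (a 0) (a 1) (a 2) (a 3) (a 4) := by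
  refine ((CompP.eq (.var 2) (.const 0)).and ?_).or
    ((CompP.ne (.var 2) (.const 0)).and compP_derive)
  exact compP_clash.comp₄ (p := fun m n X x y => Clash (AdjMem m n) (domSize m n)
    (domTable m n (source m n)) (digit m n X) x y) (.var 0) (.var 1) (.var 3) (.var 4)

theorem comp_relEntry : Comp fun m a => relEntry m (a 1) (a 0) := by
  have h3 : Comp fun _ a => 3 * a 1 := (Comp.const 3).mul (.var 1)
  have hs : Comp fun _ a => steps (a 1) + 1 :=
    (comp_steps.comp₁ (f := fun _ n => steps n) (.var 1)).add (.const 1)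
  have hi : Comp fun _ a => a 0 / (3 * a 1) := (Comp.var 0).div h3
  have hii : Comp fun _ a => a 0 / (3 * a 1) / (3 * a 1) := hi.div h3
  exact Comp.comp₅ (f := fun m n X t x y => ind (NextRel m n X t x y)) compP_nextRel (.var 1)
    (hii.div hs) (hii.mod hs) (hi.mod h3) ((Comp.var 0).mod h3)

theorem comp_answer : Comp fun m a => answer m (a 0) := by
  refine CompP.ex (P := fun m X a => ∃ c < 3, ¬ RelMem m (a 0) X (steps (a 0)) c c)
    comp_colorings ?_
  refine CompP.ex (B := fun _ _ => 3) (P := fun m c a => ¬ RelMem m (a 1) (a 0) (steps (a 1)) c c)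
    (.const 3) (CompP.not ?_)
  exact compP_relMem (.var 2) (.var 1) (comp_steps.comp₁ (f := fun _ n => steps n) (.var 2))
    (.var 0) (.var 0)

/-! ### Correctness of the tables -/

section Congr

variable {m m' : ℕ → ℕ} {n : ℕ}

/-- This and the following congruences show that each quantity reads only an initial part of the
memory, so tables appended later leave it unchanged. -/
theorem AdjMem.congr (h : ∀ k < n * n, m k = m' k) : AdjMem m n = AdjMem m' n := by
  funext u v
  refine propext (and_congr_right fun hu => and_congr_right fun hv => ?_)
  rw [h]
  nlinarith

theorem index_lt {n s t : ℕ} (hs : s < n + 1) (ht : t < n) : s * n + t < (n + 1) * n := by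
  nlinarith

theorem listSize_congr (h : ∀ k < powBase n, m k = m' k) {s : ℕ} (hs : s < n + 1) :
    listSize m n s = listSize m' n s := by
  rw [listSize, listSize, AdjMem.congr fun k hk => h k (Nat.lt_add_right _ hk)]
  exact rounds_congr fun j hj => h _ (Nat.add_lt_add_left (index_lt hs hj) _)

theorem source_spec (m : ℕ → ℕ) (n : ℕ) :
    source m n < n + 1 ∧ ∀ s' < n + 1, listSize m n (source m n) ≤ listSize m n s' := by
  obtain ⟨s, hs, h⟩ := Finset.exists_min_image (Finset.range (n + 1)) (listSize m n) ⟨0, by simp⟩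
  exact first_spec (p := fun s => ∀ s' < n + 1, listSize m n s ≤ listSize m n s')
    ⟨s, by simpa using hs, by simpa using h⟩

theorem source_congr (h : ∀ k < powBase n, m k = m' k) : source m n = source m' n := by
  unfold source first
  refine Finset.sum_congr rfl fun v hv => ?_
  have hv' := Finset.mem_range.1 hv
  congr 1
  refine propext (forall_congr' fun u => imp_congr_right fun hu => not_congr
    (forall_congr' fun s' => imp_congr_right fun hs' => ?_))
  rw [listSize_congr h (show u < n + 1 by omega), listSize_congr h hs']

theorem domSize_congr (h : ∀ k < powBase n, m k = m' k) : domSize m n = domSize m' n := by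
  rw [domSize, domSize, ← source_congr h, listSize_congr h (source_spec m n).1]

theorem domSize_le (m : ℕ → ℕ) (n : ℕ) : domSize m n ≤ n := rounds_le

theorem colorings_congr (h : ∀ k < relBase n, m k = m' k) : colorings m n = colorings m' n := by
  rw [colorings, colorings, ← domSize_congr fun k hk => h k (Nat.lt_add_right _ hk)]
  have := domSize_le m n
  exact h _ (by unfold relBase; omega)

theorem excluded_congr (h : ∀ k < relBase n, m k = m' k) (X x : ℕ) :
    Excluded (domSize m n) (domTable m n (source m n)) (digit m n X) x ↔
      Excluded (domSize m' n) (domTable m' n (source m' n)) (digit m' n X) x := by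
  have h1 : ∀ k < powBase n, m k = m' k := fun k hk => h k (Nat.lt_add_right _ hk)
  rw [← domSize_congr h1, ← source_congr h1]
  refine exists_congr fun j => and_congr_right fun hj => ?_
  have hjn := hj.trans_le (domSize_le m n)
  have h2 : m (powBase n + j) = m' (powBase n + j) := h _ (by unfold relBase; omega)
  have h3 : domTable m n (source m n) j = domTable m' n (source m n) j :=
    h1 _ (Nat.add_lt_add_left (index_lt (source_spec m n).1 hjn) _)
  rw [digit, digit, h2, h3]

theorem clash_congr (h : ∀ k < relBase n, m k = m' k) (X : ℕ) :
    Clash (AdjMem m n) (domSize m n) (domTable m n (source m n)) (digit m n X) =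
      Clash (AdjMem m' n) (domSize m' n) (domTable m' n (source m' n)) (digit m' n X) := by
  funext x y
  rw [Clash, Clash, excluded_congr h, excluded_congr h, AdjMem.congr fun k hk => h k
    (Nat.lt_add_right _ (Nat.lt_add_right _ hk))]

end Congr

/-- The adjacency relation of a graph on `Fin n`, as a relation on natural numbers. -/
def natAdj {n : ℕ} (G : SimpleGraph (Fin n)) (u v : ℕ) : Prop :=
  ∃ (hu : u < n) (hv : v < n), G.Adj ⟨u, hu⟩ ⟨v, hv⟩

theorem mul_add_div_mod {N y : ℕ} (hy : y < N) (a : ℕ) :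
    (a * N + y) / N = a ∧ (a * N + y) % N = y :=
  ⟨by rw [Nat.add_comm, Nat.add_mul_div_right _ _ (by omega), Nat.div_eq_of_lt hy, Nat.zero_add],
    by rw [Nat.mul_comm, Nat.mul_add_mod, Nat.mod_eq_of_lt hy]⟩

theorem mul_add_le_mul {a b : ℕ} (h : a + 1 ≤ b) (N : ℕ) : a * N + N ≤ b * N := by
  have := Nat.mul_le_mul_right N h
  rwa [Nat.add_mul, Nat.one_mul] at this

/-- Unfolding exposes `AdjMem m n` to rewriting. -/
theorem candidate_eq (m : ℕ → ℕ) (n s : ℕ) :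
    Candidate m n s = fun v => s = n ∨ AdjMem m n s v := rfl

theorem adjMem_graphInput {n : ℕ} (G : SimpleGraph (Fin n)) :
    AdjMem (graphInput G).mem n = natAdj G := by
  funext u v
  refine propext ⟨?_, ?_⟩
  · rintro ⟨hu, hv, h⟩
    refine ⟨hu, hv, ?_⟩
    simp only [graphInput, ne_eq, ite_eq_right_iff, one_ne_zero, imp_false, not_not] at h
    obtain ⟨i, j, h1, h2⟩ := h
    obtain ⟨h3, h4⟩ := mul_add_div_mod hv u
    obtain ⟨h5, h6⟩ := mul_add_div_mod j.2 i
    rw [h1, h5] at h3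
    rw [h1, h6] at h4
    convert h2
    · exact h3.symm
    · exact h4.symm
  · rintro ⟨hu, hv, h⟩
    refine ⟨hu, hv, ?_⟩
    simp only [graphInput, ne_eq, ite_eq_right_iff, one_ne_zero, imp_false, not_not]
    exact ⟨_, _, rfl, h⟩

/-- The greedy lists can be computed in polynomial time. -/
theorem exists_greedy : ∃ p K, ∀ (s : State) (n M : ℕ), 2 ≤ M → s.reg 0 = n → n ≤ M →
    (∀ k, s.mem k ≤ M) → Runs p s (M ^ K) fun s' => s'.reg 0 = n ∧ (∀ k, s'.mem k ≤ M) ∧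
      AdjMem s'.mem n = AdjMem s.mem n ∧ ∀ i < n + 1, ∀ t < n, domTable s'.mem n i t =
        pick n (AdjMem s'.mem n) (Candidate s'.mem n i) (domTable s'.mem n i) t := by
  obtain ⟨p, K, h⟩ := exists_fill (base := fun _ n => n * n) (size := fun _ n => (n + 1) * n)
    ((Comp.var 0).mul (.var 0)) (((Comp.var 0).add (.const 1)).mul (.var 0)) comp_domEntry
  refine ⟨p, K, fun s n M hM h0 hn hm => (h s M n hM h0 hn hm ?_ ?_).mono le_rfl ?_⟩
  · intro i hi m m' hb hb' hlt
    have hA : AdjMem m n = AdjMem m' n := AdjMem.congr fun k hk => (hb k hk).trans (hb' k hk).symm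
    simp only [domEntry, candidate_eq, hA]
    refine pick_congr fun j hj => hlt _ ?_
    have := Nat.div_add_mod' i n
    omega
  -- Even a search without success returns at most `n`.
  · exact fun i _ m _ _ => (first_le _ _).trans hn
  · rintro s' ⟨h1, h2, h3, h4⟩
    refine ⟨h1, h2, AdjMem.congr h3, fun i hi t ht => ?_⟩
    have h5 := h4 _ (index_lt hi ht)
    obtain ⟨h6, h7⟩ := mul_add_div_mod ht i
    rwa [domEntry, h6, h7] at h5

/-- The powers of three can be computed in polynomial time. -/
theorem exists_powers : ∃ p K, ∀ (s : State) (n M : ℕ), 2 ≤ M → s.reg 0 = n → n ≤ M →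
    (∀ k, s.mem k ≤ M) → 3 ^ domSize s.mem n ≤ M →
    Runs p s (M ^ K) fun s' => s'.reg 0 = n ∧ (∀ k, s'.mem k ≤ M) ∧
      (∀ k < powBase n, s'.mem k = s.mem k) ∧
      ∀ j ≤ domSize s.mem n, s'.mem (powBase n + j) = 3 ^ j := by
  obtain ⟨p, K, h⟩ := exists_fill (base := fun _ n => powBase n)
    (size := fun m n => domSize m n + 1) comp_powBase (comp_domSize.add (.const 1)) comp_powEntry
  have key : ∀ (m : ℕ → ℕ) (n i : ℕ), (∀ j < i, m (powBase n + j) = powEntry m n j) →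
      ∀ j ≤ i, powEntry m n j = 3 ^ j := by
    intro m n i h j
    induction j with
    | zero => simp [powEntry]
    | succ j ih =>
      intro hj
      rw [powEntry, if_neg (by omega), Nat.add_sub_cancel, h j (by omega), ih (by omega), pow_succ']
  refine ⟨p, K, fun s n M hM h0 hn hm hk => (h s M n hM h0 hn hm ?_ ?_).mono le_rfl ?_⟩
  · intro i hi m m' hb hb' hlt
    rcases Nat.eq_zero_or_pos i with rfl | hi0
    · simp [powEntry]
    · rw [powEntry, powEntry, hlt (i - 1) (by omega)]
  · intro i hi m hb hlt
    rw [key m n i hlt i le_rfl]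
    exact (Nat.pow_le_pow_right (by omega) (by omega)).trans hk
  · rintro s' ⟨h1, h2, h3, h4⟩
    refine ⟨h1, h2, h3, fun j hj => ?_⟩
    rw [h4 j (by omega)]
    exact key _ n (domSize s.mem n) (fun j hj => h4 j (by omega)) j hj

/-- The closures for all colourings of the dominating list can be computed in time polynomial in
`n` and the number of these colourings. -/
theorem exists_closure : ∃ p K, ∀ (s : State) (n M : ℕ), 2 ≤ M → s.reg 0 = n → 0 < n → n ≤ M →
    (∀ k, s.mem k ≤ M) → Runs p s (M ^ K) fun s' => s'.reg 0 = n ∧ (∀ k, s'.mem k ≤ M) ∧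
      (∀ k < relBase n, s'.mem k = s.mem k) ∧
      ∀ X < colorings s.mem n, ∀ t ≤ steps n, ∀ x < 3 * n, ∀ y < 3 * n,
        RelMem s'.mem n X t x y ↔ (Derive n)^[t] (Clash (AdjMem s.mem n) (domSize s.mem n)
          (domTable s.mem n (source s.mem n)) (digit s.mem n X)) x y := by
  obtain ⟨p, K, h⟩ := exists_fill (base := fun _ n => relBase n)
    (size := fun m n => colorings m n * (steps n + 1) * (3 * n) * (3 * n)) comp_relBase
    (((comp_colorings.mul (comp_steps.add (.const 1))).mul comp_three_mul).mul comp_three_mul)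
    comp_relEntry
  -- The time coordinate is more significant than the two literals, so the previous stage for the
  -- same colouring is stored before the current one.
  have hlt_index : ∀ {n X t x y x' y' : ℕ}, x' < 3 * n → y' < 3 * n → t ≠ 0 →
      relIndex n X (t - 1) x' y' < relIndex n X t x y := by
    intro n X t x y x' y' hx' hy' ht
    obtain ⟨t, rfl⟩ := Nat.exists_eq_succ_of_ne_zero ht
    simp only [Nat.succ_eq_add_one, Nat.add_sub_cancel, relIndex]
    have h1 : (X * (steps n + 1) + t) * (3 * n) + x' + 1 ≤
        (X * (steps n + 1) + (t + 1)) * (3 * n) + x := by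
      have := mul_add_le_mul (le_refl (X * (steps n + 1) + t + 1)) (3 * n)
      rw [← add_assoc]
      omega
    have h2 := mul_add_le_mul h1 (3 * n)
    omega
  refine ⟨p, K, fun s n M hM h0 hn0 hn hm => (h s M n hM h0 hn hm ?_ ?_).mono le_rfl ?_⟩
  · intro i hi m m' hb hb' hlt
    have hbb : ∀ k < relBase n, m k = m' k := fun k hk => (hb k hk).trans (hb' k hk).symm
    rw [relEntry, relEntry]
    congr 1
    rw [NextRel, NextRel, clash_congr hbb]
    refine propext (or_congr Iff.rfl (and_congr_right fun ht => ?_))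
    refine Derive.congr (fun x hx y hy => ?_) (Nat.mod_lt _ (by omega)) (Nat.mod_lt _ (by omega))
    have hi' : relIndex n (i / (3 * n) / (3 * n) / (steps n + 1))
        (i / (3 * n) / (3 * n) % (steps n + 1)) (i / (3 * n) % (3 * n)) (i % (3 * n)) = i := by
      rw [relIndex, Nat.div_add_mod', Nat.div_add_mod', Nat.div_add_mod']
    rw [RelMem, RelMem, hlt _ ((hlt_index hx hy ht).trans_eq hi')]
  · exact fun i _ m _ _ => (ind_le_one _).trans (by omega)
  · rintro s' ⟨h1, h2, h3, h4⟩
    refine ⟨h1, h2, h3, fun X hX t => ?_⟩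
    have hstep : ∀ t ≤ steps n, ∀ x < 3 * n, ∀ y < 3 * n,
        RelMem s'.mem n X t x y ↔ NextRel s'.mem n X t x y := by
      intro t ht x hx y hy
      have hX' : X * (steps n + 1) + t + 1 ≤ colorings s.mem n * (steps n + 1) := by
        have := mul_add_le_mul (Nat.succ_le_of_lt hX) (steps n + 1)
        omega
      have hx' := mul_add_le_mul hX' (3 * n)
      have hy' := mul_add_le_mul (show (X * (steps n + 1) + t) * (3 * n) + x + 1 ≤
        colorings s.mem n * (steps n + 1) * (3 * n) by omega) (3 * n)
      have h5 := h4 (relIndex n X t x y) (by unfold relIndex; omega)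
      rw [RelMem, h5, relEntry, ind_ne_zero, relIndex]
      obtain ⟨e1, e2⟩ := mul_add_div_mod hy ((X * (steps n + 1) + t) * (3 * n) + x)
      obtain ⟨e3, e4⟩ := mul_add_div_mod hx (X * (steps n + 1) + t)
      obtain ⟨e5, e6⟩ := mul_add_div_mod (show t < steps n + 1 by omega) X
      rw [e1, e2, e3, e4, e5, e6]
    induction t with
    | zero =>
      intro ht x hx y hy
      rw [hstep 0 ht x hx y hy, NextRel, clash_congr h3]
      simp
    | succ t ih =>
      intro ht x hx y hy
      rw [hstep _ ht x hx y hy, NextRel, Function.iterate_succ_apply']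
      simp only [Nat.succ_ne_zero, false_and, false_or, ne_eq, not_false_eq_true, true_and,
        Nat.add_sub_cancel]
      exact Derive.congr (ih (by omega)) hx hy

theorem colorable_three_iff {n : ℕ} (G : SimpleGraph (Fin n)) : G.Colorable 3 ↔
    ∃ f : ℕ → ℕ, (∀ u, f u < 3) ∧ ∀ u < n, ∀ v < n, natAdj G u v → f u ≠ f v := by
  constructor
  · rintro ⟨C⟩
    refine ⟨fun u => if h : u < n then C ⟨u, h⟩ else 0, fun u => ?_, fun u hu v hv h => ?_⟩
    · dsimp only
      split_ifs
      · exact (C _).2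
      · omega
    · obtain ⟨_, _, h⟩ := h
      simp only [hu, hv, dif_pos]
      exact fun he => C.valid h (Fin.ext he)
  · rintro ⟨f, h3, hf⟩
    exact ⟨SimpleGraph.Coloring.mk (fun u => ⟨f u, h3 u⟩) fun {u v} h he =>
      hf u u.2 v v.2 ⟨u.2, v.2, h⟩ (by simpa using he)⟩

/-- Three-colourability of graphs in which every neighbourhood dominates is decided in time
polynomial in `n` and `3 ^ k`, where `k` is at most the size of every dominating set chosen
greedily. -/
theorem exists_program : ∃ p K, ∀ (n : ℕ) (G : SimpleGraph (Fin n)), 0 < n →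
    (∀ i < n + 1, ∀ w < n, ∃ v < n, (i = n ∨ natAdj G i v) ∧ (v = w ∨ natAdj G v w)) →
    ∃ k, (∀ i < n + 1, ∃ D : ℕ → ℕ,
      (∀ t < n, D t = pick n (natAdj G) (fun v => i = n ∨ natAdj G i v) D t) ∧
        k ≤ rounds n (natAdj G) D) ∧
      ∃ t, DecidesThreeColoring p G t ∧ t ≤ ((n + 2) * 3 ^ k) ^ K := by
  obtain ⟨p₁, K₁, h₁⟩ := exists_greedy
  obtain ⟨p₂, K₂, h₂⟩ := exists_powers
  obtain ⟨p₃, K₃, h₃⟩ := exists_closure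
  obtain ⟨p₄, K₄, h₄⟩ := comp_answer (fun _ => 0) 1 (by simp)
  refine ⟨.seq p₁ (.seq p₂ (.seq p₃ (.seq p₄ (.seq (.const 0 0) (.add 0 0 1))))),
    K₁ + (K₂ + (K₃ + (K₄ + 1 + 1) + 1) + 1) + 1, fun n G hn hdom => ?_⟩
  -- The length `k` is known only after the greedy phase, which therefore runs with the bound `n +
  -- 2`; later phases use `(n + 2) * 3 ^ k`.
  obtain ⟨t₁, s₁, hE₁, ht₁, h01, hm1, hA1, hD1⟩ := h₁ (graphInput G) n (n + 2) (by omega)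
    (by simp [graphInput]) (by omega) (fun k => by simp only [graphInput]; split_ifs <;> omega)
  rw [adjMem_graphInput] at hA1
  simp only [candidate_eq, hA1] at hD1
  set k := domSize s₁.mem n with hk
  obtain ⟨hsrc, hmin⟩ := source_spec s₁.mem n
  refine ⟨k, fun i hi => ⟨domTable s₁.mem n i, hD1 i hi, ?_⟩, ?_⟩
  · have := hmin i hi
    rw [listSize, listSize, hA1] at this
    rwa [hk, domSize, listSize, hA1]
  set M := (n + 2) * 3 ^ k with hM
  have hnM : n + 2 ≤ M := Nat.le_mul_of_pos_right _ (by positivity)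
  have hkM : 3 ^ k ≤ M := Nat.le_mul_of_pos_left _ (by omega)
  have h2M : 2 ≤ M := by omega
  have e0 : M ^ K₄ + 2 ≤ M ^ (K₄ + 1 + 1) := by
    have := pow_add_pow_le h2M K₄ 1
    rw [pow_one] at this
    omega
  have e1 := pow_add_pow_le h2M K₃ (K₄ + 1 + 1)
  have e2 := pow_add_pow_le h2M K₂ (K₃ + (K₄ + 1 + 1) + 1)
  have e3 := pow_add_pow_le h2M K₁ (K₂ + (K₃ + (K₄ + 1 + 1) + 1) + 1)
  have hstart : Runs p₁ (graphInput G) (M ^ K₁) (fun s => s = s₁) :=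
    ⟨t₁, s₁, hE₁, ht₁.trans (Nat.pow_le_pow_left hnM _), rfl⟩
  suffices H : Runs (.seq p₁ (.seq p₂ (.seq p₃ (.seq p₄ (.seq (.const 0 0) (.add 0 0 1))))))
      (graphInput G) (M ^ K₁ + (M ^ K₂ + (M ^ K₃ + (M ^ K₄ + (1 + 1)))))
      (fun s => s.reg 0 = ind (G.Colorable 3)) by
    obtain ⟨t, s, hE, ht, hs⟩ := H
    refine ⟨t, ⟨s, hE, fun h => ?_, fun h => ?_⟩, by omega⟩
    · rw [hs, ind_of_true h]
    · rw [hs, ind_of_false h]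
  refine hstart.seq fun s hs => ?_
  rw [hs]
  clear hs s
  refine (h₂ s₁ n M h2M h01 (by omega) (fun k => (hm1 k).trans hnM) hkM).seq ?_
  rintro s₂ ⟨h02, hm2, hb2, hp2⟩
  refine (h₃ s₂ n M h2M h02 hn (by omega) hm2).seq ?_
  rintro s₃ ⟨h03, hm3, hb3, hr3⟩
  refine (h₄ s₃ M h2M (fun _ => h03.trans_le (by omega)) hm3).2.seq ?_
  rintro s₄ ⟨hm4, -, hd4⟩
  refine Runs.seq (Runs.const (Q := fun s' => s' = s₄.setReg 0 0) rfl) ?_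
  rintro _ rfl
  refine Runs.add ?_
  have hadj : AdjMem s₂.mem n = natAdj G := by
    rw [AdjMem.congr fun k hk => hb2 k (Nat.lt_add_right _ hk), hA1]
  have hsize : domSize s₂.mem n = k := domSize_congr hb2
  have hsource : source s₂.mem n = source s₁.mem n := source_congr hb2
  have hcolor : colorings s₂.mem n = 3 ^ k := by rw [colorings, hsize, hp2 k le_rfl]
  have hcand : ∀ w < n, ∃ v < n, (source s₁.mem n = n ∨ natAdj G (source s₁.mem n) v) ∧
      (v = w ∨ natAdj G v w) := hdom _ hsrc
  have hDrec := hD1 _ hsrc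
  have hkr : k = rounds n (natAdj G) (domTable s₁.mem n (source s₁.mem n)) := by
    rw [hk, domSize, listSize, hA1]
  have hDD : ∀ j < n, domTable s₂.mem n (source s₁.mem n) j =
      domTable s₁.mem n (source s₁.mem n) j :=
    fun j hj => hb2 _ (Nat.add_lt_add_left (index_lt hsrc hj) _)
  have hkn : k ≤ n := domSize_le _ _
  have hext : ∀ X, (∃ c < 3, ¬ (Derive n)^[3 * n * (3 * n)] (Clash (natAdj G) k
      (domTable s₂.mem n (source s₁.mem n)) (digit s₂.mem n X)) c c) ↔
      ∃ f : ℕ → ℕ, (∀ u, f u < 3) ∧ (∀ u < n, ∀ v < n, natAdj G u v → f u ≠ f v) ∧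
        ∀ j < k, f (domTable s₂.mem n (source s₁.mem n) j) = digit s₂.mem n X j := by
    intro X
    refine exists_coloring_iff hn (fun u v ⟨hu, hv, h⟩ => ⟨hv, hu, h.symm⟩) (fun j hj => ?_)
      (fun j => Nat.mod_lt _ (by omega)) fun w hw => ?_
    · rw [hDD j (by omega)]
      exact (pick_spec_of_lt_rounds hcand hDrec (hkr ▸ hj)).1
    · have := covered_rounds hcand hDrec hw
      rw [← hkr] at this
      rwa [Covered.congr fun j hj => hDD j (by omega)]
  have hans : answer s₃.mem n = ind (G.Colorable 3) := by
    rw [answer, colorings_congr hb3, hcolor]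
    congr 1
    refine propext ?_
    have h5 : ∀ X < 3 ^ k, (∃ c < 3, ¬ RelMem s₃.mem n X (steps n) c c) ↔
        ∃ f : ℕ → ℕ, (∀ u, f u < 3) ∧ (∀ u < n, ∀ v < n, natAdj G u v → f u ≠ f v) ∧
          ∀ j < k, f (domTable s₂.mem n (source s₁.mem n) j) = digit s₂.mem n X j := by
      intro X hX
      rw [← hext X]
      refine exists_congr fun c => and_congr_right fun hc => not_congr ?_
      rw [hr3 X (by rwa [hcolor]) _ le_rfl c (by omega) c (by omega), hadj, hsize, hsource]
      rfl
    rw [colorable_three_iff]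
    constructor
    · rintro ⟨X, hX, h⟩
      obtain ⟨f, hf3, hf, -⟩ := (h5 X hX).1 h
      exact ⟨f, hf3, hf⟩
    · rintro ⟨f, hf3, hf⟩
      -- The restriction of a colouring to the dominating list is one of the numbers tried.
      obtain ⟨X, hX, hdig⟩ := exists_digits
        (fun j => f (domTable s₂.mem n (source s₁.mem n) j)) (fun j => hf3 _) k
      refine ⟨X, hX, (h5 X hX).2 ⟨f, hf3, hf, fun j hj => ?_⟩⟩
      rw [digit, hp2 j hj.le, hdig j hj]
  simp [State.setReg, hd4, h03, hans]

/-! ### Graphs of diameter two -/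

section DiamTwo

variable {V : Type*} {G : SimpleGraph V}

/-- Since `diam` is 0 when the extended diameter is infinite, the value 2 forces connectedness, and
a shortest walk has at most two edges. -/
theorem exists_adj_adj_of_diam_eq_two (h : G.diam = 2) {u v : V} (huv : u ≠ v)
    (hadj : ¬ G.Adj u v) : ∃ w, G.Adj u w ∧ G.Adj w v := by
  have htop : G.ediam ≠ ⊤ := SimpleGraph.ediam_ne_top_of_diam_ne_zero (by omega)
  have hconn := SimpleGraph.preconnected_of_ediam_ne_top htop
  obtain ⟨p, hp⟩ := (hconn u v).exists_walk_length_eq_dist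
  have h2 : p.length ≤ 2 := hp ▸ h ▸ SimpleGraph.dist_le_diam htop
  match p, h2 with
  | .nil, _ => exact absurd rfl huv
  | .cons h1 .nil, _ => exact absurd h1 hadj
  | .cons h1 (.cons h2 .nil), _ => exact ⟨_, h1, h2⟩
  | .cons _ (.cons _ (.cons _ _)), h2 => simp at h2

theorem exists_not_adj_of_diam_eq_two (h : G.diam = 2) : ∃ u v, u ≠ v ∧ ¬ G.Adj u v := by
  have hnt := SimpleGraph.nontrivial_of_diam_ne_zero (G := G) (by omega)
  obtain ⟨u, v, huv⟩ := SimpleGraph.exists_dist_eq_diam (G := G)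
  rw [h] at huv
  refine ⟨u, v, ?_, fun hadj => ?_⟩
  · rintro rfl
    simp at huv
  · rw [SimpleGraph.dist_eq_one_iff_adj.2 hadj] at huv
    omega

theorem exists_adj_of_diam_eq_two (h : G.diam = 2) (u : V) : ∃ v, G.Adj u v := by
  have hnt := SimpleGraph.nontrivial_of_diam_ne_zero (G := G) (by omega)
  obtain ⟨v, hv⟩ := exists_ne u
  by_cases hadj : G.Adj u v
  · exact ⟨v, hadj⟩
  · obtain ⟨w, hw, -⟩ := exists_adj_adj_of_diam_eq_two h hv.symm hadj
    exact ⟨w, hw⟩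

theorem three_le_card_of_diam_eq_two [Fintype V] (h : G.diam = 2) : 3 ≤ Fintype.card V := by
  obtain ⟨u, v, huv, hadj⟩ := exists_not_adj_of_diam_eq_two h
  obtain ⟨w, h1, h2⟩ := exists_adj_adj_of_diam_eq_two h huv hadj
  exact Fintype.two_lt_card_iff.2 ⟨u, v, w, huv, h1.ne, h2.ne'⟩

end DiamTwo

section Fin

variable {n : ℕ} {G : SimpleGraph (Fin n)}

/-- The vertex `i` itself is dominated by any neighbour, a neighbour by itself, any other vertex by
a common neighbour. For `i = n` every vertex is a candidate and dominates itself. -/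
theorem exists_dominating_of_diam_eq_two (h : G.diam = 2) {i w : ℕ} (hi : i < n + 1) (hw : w < n) :
    ∃ v < n, (i = n ∨ natAdj G i v) ∧ (v = w ∨ natAdj G v w) := by
  rcases Nat.lt_succ_iff_lt_or_eq.1 hi with hi | rfl
  · by_cases hiw : i = w
    · subst hiw
      obtain ⟨v, hv⟩ := exists_adj_of_diam_eq_two h ⟨i, hi⟩
      exact ⟨v, v.2, .inr ⟨hi, v.2, hv⟩, .inr ⟨v.2, hi, hv.symm⟩⟩
    · by_cases hadj : G.Adj ⟨i, hi⟩ ⟨w, hw⟩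
      · exact ⟨w, hw, .inr ⟨hi, hw, hadj⟩, .inl rfl⟩
      · obtain ⟨v, h1, h2⟩ := exists_adj_adj_of_diam_eq_two h (by simpa using hiw) hadj
        exact ⟨v, v.2, .inr ⟨hi, v.2, h1⟩, .inr ⟨v.2, hw, h2⟩⟩
  · exact ⟨w, hw, .inl rfl, .inl rfl⟩

variable [DecidableRel G.Adj]

theorem card_natAdj (v : Fin n) :
    ((G.neighborFinset v).map Fin.valEmbedding).card = G.degree v := by
  rw [Finset.card_map, SimpleGraph.card_neighborFinset_eq_degree]

theorem mem_natAdj {v : Fin n} {u : ℕ} :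
    u ∈ (G.neighborFinset v).map Fin.valEmbedding ↔ natAdj G v u := by
  simp only [Finset.mem_map, SimpleGraph.mem_neighborFinset, Fin.valEmbedding_apply]
  constructor
  · rintro ⟨w, hw, rfl⟩
    exact ⟨v.2, w.2, hw⟩
  · rintro ⟨_, hu, h⟩
    exact ⟨⟨u, hu⟩, h, rfl⟩

/-- Some greedy dominating set is at most as large as the minimum degree, and another one at most
as large as `O(n / δ * log δ)`. -/
theorem le_of_greedy (h : G.diam = 2) {k : ℕ}
    (hk : ∀ i < n + 1, ∃ D : ℕ → ℕ,
      (∀ t < n, D t = pick n (natAdj G) (fun v => i = n ∨ natAdj G i v) D t) ∧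
        k ≤ rounds n (natAdj G) D) :
    k ≤ G.minDegree ∧ (2 ≤ G.minDegree →
      (k : ℝ) ≤ 3 * ((n : ℝ) / G.minDegree * Real.logb 2 G.minDegree)) := by
  classical
  have hn : 3 ≤ n := by simpa using three_le_card_of_diam_eq_two h
  have : Nonempty (Fin n) := ⟨⟨0, by omega⟩⟩
  obtain ⟨v, hv⟩ := G.exists_minimal_degree_vertex
  refine ⟨?_, fun h2 => ?_⟩
  · obtain ⟨D, hD, hkD⟩ := hk v (by omega)
    refine hkD.trans ((rounds_le_card (fun w hw => exists_dominating_of_diam_eq_two h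
      (by omega) hw) hD).trans ?_)
    rw [hv, ← card_natAdj]
    refine Finset.card_le_card fun u hu => mem_natAdj.2 ?_
    rcases (Finset.mem_filter.1 hu).2 with hvn | hu
    · exact absurd hvn v.2.ne
    · exact hu
  · obtain ⟨D, hD, hkD⟩ := hk n (by omega)
    refine (Nat.cast_le.2 hkD).trans (rounds_le_log (fun w hw =>
      exists_dominating_of_diam_eq_two h (by omega) hw) hD (fun _ => .inl rfl) (fun w hw => ?_) h2 ?_)
    · have h3 := G.minDegree_le_degree ⟨w, hw⟩
      rw [← card_natAdj] at h3
      obtain ⟨S, hS, hcard⟩ := Finset.exists_subset_card_eq h3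
      refine ⟨S, hcard, fun u hu => ?_⟩
      obtain ⟨h4, h5, h6⟩ := mem_natAdj.1 (hS hu)
      exact ⟨h5, h5, h4, h6.symm⟩
    · have := G.degree_lt_card_verts v
      rw [Fintype.card_fin] at this
      omega

end Fin

/-! ### Estimates of the running time -/

theorem min_nonneg {n δ : ℕ} (hδ : 1 ≤ δ) :
    0 ≤ min (δ : ℝ) ((n : ℝ) / δ * Real.logb 2 δ) :=
  le_min (Nat.cast_nonneg _) (mul_nonneg (by positivity)
    (Real.logb_nonneg (by norm_num) (by exact_mod_cast hδ)))

/-- Split log n into log δ and log (n/δ). By Bernoulli the latter is at most n/δ, so both are at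
most (n/δ) log δ. -/
theorem logb_le_two_mul {n δ : ℕ} (h2 : 2 ≤ δ) (hδn : δ ≤ n) :
    Real.logb 2 n ≤ 2 * ((n : ℝ) / δ * Real.logb 2 δ) := by
  have hδ2 : (2 : ℝ) ≤ δ := by exact_mod_cast h2
  have hδn' : (δ : ℝ) ≤ n := by exact_mod_cast hδn
  have hm : (1 : ℝ) ≤ n / δ := by rwa [le_div_iff₀ (by linarith), one_mul]
  have hlog : 1 ≤ Real.logb 2 δ := by
    rw [Real.le_logb_iff_rpow_le (by norm_num) (by linarith)]
    simpa using hδ2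
  have h3 : Real.logb 2 (n / δ) ≤ n / δ := by
    rw [Real.logb_le_iff_le_rpow (by norm_num) (by linarith)]
    have h4 := one_add_mul_self_le_rpow_one_add (show (-1 : ℝ) ≤ 1 by norm_num) hm
    norm_num at h4
    linarith
  have h5 : Real.logb 2 n = Real.logb 2 δ + Real.logb 2 (n / δ) := by
    rw [← Real.logb_mul (by linarith) (by linarith)]
    congr 1
    have : (δ : ℝ) ≠ 0 := by linarith
    field_simp
  nlinarith

/-- Use 3 ≤ 2², so that `3 ^ k` is at most 4 · 2^(6μ), and bound both 4 and `n + 2` by `n ^ 2`. -/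
theorem time_le {n k K : ℕ} {μ : ℝ} (hn : 3 ≤ n) (hk : (k : ℝ) ≤ 3 * μ + 1) :
    ((((n + 2) * 3 ^ k) ^ K : ℕ) : ℝ) ≤ (n : ℝ) ^ (4 * K) * (2 : ℝ) ^ (6 * K * μ) := by
  have hn' : (3 : ℝ) ≤ n := by exact_mod_cast hn
  have h1 : (3 : ℝ) ^ k ≤ (n : ℝ) ^ 2 * (2 : ℝ) ^ (6 * μ) := by
    calc (3 : ℝ) ^ k ≤ (4 : ℝ) ^ k := by gcongr; norm_num
      _ = (2 : ℝ) ^ (2 * (k : ℝ)) := by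
        rw [Real.rpow_mul (by norm_num), Real.rpow_natCast]
        norm_num
      _ ≤ (2 : ℝ) ^ (2 + 6 * μ) := Real.rpow_le_rpow_of_exponent_le (by norm_num) (by linarith)
      _ = 4 * (2 : ℝ) ^ (6 * μ) := by
        rw [Real.rpow_add (by norm_num)]
        norm_num
      _ ≤ _ := by
        gcongr
        nlinarith
  have h2 : (n : ℝ) + 2 ≤ (n : ℝ) ^ 2 := by nlinarith
  calc ((((n + 2) * 3 ^ k) ^ K : ℕ) : ℝ) = (((n : ℝ) + 2) * 3 ^ k) ^ K := by push_cast; rfl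
    _ ≤ ((n : ℝ) ^ 2 * ((n : ℝ) ^ 2 * (2 : ℝ) ^ (6 * μ))) ^ K := by gcongr
    _ = (n : ℝ) ^ (4 * K) * ((2 : ℝ) ^ (6 * μ)) ^ K := by ring
    _ = _ := by
      rw [← Real.rpow_natCast ((2 : ℝ) ^ (6 * μ)), ← Real.rpow_mul (by norm_num)]
      ring_nf

end RAM

theorem mainTheorem9 :
    ∃ (p : RAM.Prog) (C : ℕ), ∀ (n : ℕ) (G : SimpleGraph (Fin n)) [DecidableRel G.Adj],
      ThreeColIrreducible G → G.diam = 2 →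
      ∃ t : ℕ, RAM.DecidesThreeColoring p G t ∧
        (t : ℝ) ≤ (n : ℝ) ^ C * (2 : ℝ) ^ ((C : ℝ) *
          min (G.minDegree : ℝ) ((n : ℝ) / (G.minDegree : ℝ) * Real.logb 2 (G.minDegree : ℝ))) ∧
        (Real.logb 2 (n : ℝ) ≤ (G.minDegree : ℝ) →
          (t : ℝ) ≤ (2 : ℝ) ^ ((C : ℝ) *
            min (G.minDegree : ℝ)
              ((n : ℝ) / (G.minDegree : ℝ) * Real.logb 2 (G.minDegree : ℝ)))) := by
  obtain ⟨p, K, h⟩ := RAM.exists_program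
  -- The constant is 2 · 4K + 6K: in the second bound each of the 4K factors `n` becomes 2^(2μ).
  refine ⟨p, 14 * K, fun n G _ _ hdiam => ?_⟩
  have hn : 3 ≤ n := by simpa using RAM.three_le_card_of_diam_eq_two hdiam
  obtain ⟨k, hk, t, ht, htle⟩ := h n G (by omega)
    fun i hi w hw => RAM.exists_dominating_of_diam_eq_two hdiam hi hw
  obtain ⟨hkδ, hklog⟩ := RAM.le_of_greedy hdiam hk
  have hne : Nonempty (Fin n) := ⟨⟨0, by omega⟩⟩
  obtain ⟨v, hv⟩ := G.exists_minimal_degree_vertex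
  have hδ1 : 1 ≤ G.minDegree := by
    rw [hv]
    exact (G.degree_pos_iff_exists_adj v).2 (RAM.exists_adj_of_diam_eq_two hdiam v)
  have hδn : G.minDegree ≤ n := by
    have := G.degree_lt_card_verts v
    rw [Fintype.card_fin] at this
    omega
  have hn' : (3 : ℝ) ≤ n := by exact_mod_cast hn
  have hμ := RAM.min_nonneg (n := n) hδ1
  set μ := min (G.minDegree : ℝ) ((n : ℝ) / (G.minDegree : ℝ) * Real.logb 2 (G.minDegree : ℝ))
    with hμdef
  -- The summand 1 is for minimum degree one, where the logarithm vanishes but `k` may be 1.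
  have hkμ : (k : ℝ) ≤ 3 * μ + 1 := by
    rcases hδ1.eq_or_lt with h1 | h2
    · have : (k : ℝ) ≤ 1 := by exact_mod_cast h1 ▸ hkδ
      linarith
    · have h3 : (k : ℝ) ≤ G.minDegree := by exact_mod_cast hkδ
      have h4 : (k : ℝ) / 3 ≤ μ := le_min (by linarith [(Nat.cast_nonneg k : (0 : ℝ) ≤ k)])
        (by linarith [hklog h2])
      linarith
  have hK : (0 : ℝ) ≤ K := Nat.cast_nonneg _
  have hKμ : 0 ≤ K * μ := mul_nonneg hK hμ
  have htime : (t : ℝ) ≤ (n : ℝ) ^ (4 * K) * (2 : ℝ) ^ (6 * K * μ) :=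
    (Nat.cast_le.2 htle).trans (RAM.time_le hn hkμ)
  refine ⟨t, ht, htime.trans ?_, fun hlog => htime.trans ?_⟩
  · refine mul_le_mul ?_ ?_ (by positivity) (by positivity)
    · exact pow_le_pow_right₀ (by linarith) (by omega)
    · refine Real.rpow_le_rpow_of_exponent_le (by norm_num) ?_
      push_cast
      nlinarith
  -- As `n ≥ 3`, its binary logarithm exceeds 1, which rules out minimum degree one.
  · have h2 : 2 ≤ G.minDegree := by
      have h3 : 1 < Real.logb 2 n := by
        rw [Real.lt_logb_iff_rpow_lt (by norm_num) (by linarith)]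
        norm_num
        linarith
      exact_mod_cast h3.trans_le hlog
    have h4 : Real.logb 2 n ≤ 2 * μ := by
      have h5 := RAM.logb_le_two_mul h2 hδn
      have : Real.logb 2 n / 2 ≤ μ := le_min (by linarith [(Nat.cast_nonneg G.minDegree :
        (0 : ℝ) ≤ G.minDegree)]) (by linarith)
      linarith
    have h6 : (n : ℝ) ≤ (2 : ℝ) ^ (2 * μ) :=
      (Real.logb_le_iff_le_rpow (by norm_num) (by linarith)).1 h4
    calc (n : ℝ) ^ (4 * K) * (2 : ℝ) ^ (6 * K * μ)
        ≤ ((2 : ℝ) ^ (2 * μ)) ^ (4 * K) * (2 : ℝ) ^ (6 * K * μ) := by gcongr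
      _ = (2 : ℝ) ^ ((14 * K : ℕ) * μ) := by
        rw [← Real.rpow_natCast, ← Real.rpow_mul (by norm_num), ← Real.rpow_add (by norm_num)]
        push_cast
        ring_nf
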